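/- Call a group $G$ a Tarski monster if it is not cyclic and all of its proper subgroups are cyclic. Let $G$ be a simple Tarski monster and let $n \ge 4$. Let $F_n$ be the free group on $x_1,\dots,x_n$ and $\operatorname{Out}(F_n)=\operatorname{Aut}(F_n)/\operatorname{Inn}(F_n)$. Let $V_n(G)$ be the set of $n$-tuples $\underline g=(g_1,\dots,g_n)\in G^n$ that generate $G$, identified with the set of epimorphisms $F_n\to G$ via $x_i\mapsto g_i$, and let $\bar V_n(G)$ be the set of orbits of $\operatorname{Aut}(G)$ acting on $V_n(G)$ by post-composition. The action of $\operatorname{Aut}(F_n)$ on $V_n(G)$ by pre-composition (made into a left action by $\alpha\cdot\varphi=\varphi\circ\alpha^{-1}$) induces an action of $\operatorname{Out}(F_n)$ on $\bar V_n(G)$. This action is highly transitive, that is, for every $k\in\mathbf N$ it is transitive on ordered $k$-tuples of distinct points of $\bar V_n(G)$. Moreover, it is faithful if and only if $G$ satisfies no group law, that is, if and only if there are no $m$ and no non-trivial word $w\in F_m$ such that $w(\underline g)=1$ for all $\underline g\in G^m$. -/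

import Mathlib

/-- A Tarski monster: a noncyclic group all of whose proper subgroups are cyclic. -/
def IsTarskiMonster (G : Type*) [Group G] : Prop :=
  ¬ IsCyclic G ∧ ∀ H : Subgroup G, H ≠ ⊤ → IsCyclic H

/-- `G` satisfies a group law: some non-trivial word `w ∈ F_m` vanishes on all of `G ^ m`. -/
def SatisfiesGroupLaw (G : Type*) [Group G] : Prop :=
  ∃ (m : ℕ) (w : FreeGroup (Fin m)), w ≠ 1 ∧ ∀ g : Fin m → G, FreeGroup.lift g w = 1

/-- An action is highly transitive if, for every `k`, it is transitive on ordered `k`-tuples of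
distinct points. -/
def IsHighlyTransitive (M : Type*) (X : Type*) [Group M] [MulAction M X] : Prop :=
  ∀ k : ℕ, MulAction.IsMultiplyPretransitive M X k

/-- `Inn(F)`, the subgroup of inner automorphisms. -/
def Inn (F : Type*) [Group F] : Subgroup (MulAut F) := (MulAut.conj : F →* MulAut F).range

instance Inn.normal (F : Type*) [Group F] : (Inn F).Normal where
  conj_mem := by
    rintro _ ⟨x, rfl⟩ α
    refine ⟨α x, ?_⟩
    ext y
    simp [MulAut.mul_apply]

/-- `Out(F) = Aut(F) / Inn(F)`. -/
abbrev Out (F : Type*) [Group F] : Type _ := MulAut F ⧸ Inn F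

/-- `V_n(G)`, the set of generating `n`-tuples of `G`. -/
def GenTuple (n : ℕ) (G : Type*) [Group G] : Type _ :=
  {g : Fin n → G // Subgroup.closure (Set.range g) = ⊤}

namespace GenTuple

variable {n : ℕ} {G : Type*} [Group G]

/-- Two generating tuples are equivalent if an automorphism of `G` carries one to the other. -/
instance setoid (n : ℕ) (G : Type*) [Group G] : Setoid (GenTuple n G) where
  r g h := ∃ σ : MulAut G, ∀ i, σ (g.1 i) = h.1 i
  iseqv :=
    { refl := fun _ => ⟨1, fun _ => rfl⟩
      symm := fun ⟨σ, h⟩ => ⟨σ⁻¹, fun i => by rw [← h i]; exact MulAut.inv_apply_self G σ _⟩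
      trans := fun ⟨σ, h⟩ ⟨τ, k⟩ => ⟨τ * σ, fun i => by rw [MulAut.mul_apply, h i, k i]⟩ }

/-- The epimorphism `F_n → G` with `x_i ↦ g_i` has range the subgroup generated by the tuple. -/
theorem lift_range (g : Fin n → G) :
    (FreeGroup.lift g).range = Subgroup.closure (Set.range g) :=
  FreeGroup.range_lift_eq_closure

/-- The action of `α ∈ Aut(F_n)`: identifying the tuple `g` with the epimorphism
`φ_g : F_n → G`, `x_i ↦ g_i`, it sends `φ_g` to `φ_g ∘ α⁻¹`. (The inverse turns the right action
by precomposition into a left action.) -/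
def act (α : MulAut (FreeGroup (Fin n))) (g : GenTuple n G) : GenTuple n G :=
  ⟨fun i => FreeGroup.lift g.1 (α⁻¹ (FreeGroup.of i)), by
    have h : FreeGroup.lift (fun i => FreeGroup.lift g.1 (α⁻¹ (FreeGroup.of i)))
        = (FreeGroup.lift g.1).comp (α⁻¹ : MulAut _).toMonoidHom := by
      ext i; simp
    rw [← lift_range, h, MonoidHom.range_comp]
    have h' : ((α⁻¹ : MulAut _).toMonoidHom).range = ⊤ :=
      MonoidHom.range_eq_top.2 (α⁻¹ : MulAut _).surjective
    rw [h', ← MonoidHom.range_eq_map, lift_range]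
    exact g.2⟩

theorem lift_act (α : MulAut (FreeGroup (Fin n))) (g : GenTuple n G) (w : FreeGroup (Fin n)) :
    FreeGroup.lift (act α g).1 w = FreeGroup.lift g.1 (α⁻¹ w) := by
  have h : FreeGroup.lift (act α g).1
      = (FreeGroup.lift g.1).comp (α⁻¹ : MulAut _).toMonoidHom := by
    ext i; simp [act]
  rw [h]; rfl

theorem act_one (g : GenTuple n G) : act 1 g = g := by
  apply Subtype.ext
  funext i
  simp [act]

theorem act_mul (α β : MulAut (FreeGroup (Fin n))) (g : GenTuple n G) :
    act (α * β) g = act α (act β g) := by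
  apply Subtype.ext
  funext i
  change _ = FreeGroup.lift (act β g).1 (α⁻¹ (FreeGroup.of i))
  rw [lift_act]
  simp [act, mul_inv_rev, MulAut.mul_apply]

theorem act_equiv (α : MulAut (FreeGroup (Fin n))) {g h : GenTuple n G} (hgh : g ≈ h) :
    act α g ≈ act α h := by
  obtain ⟨σ, hσ⟩ := hgh
  refine ⟨σ, fun i => ?_⟩
  have e : FreeGroup.lift h.1 = (σ.toMonoidHom).comp (FreeGroup.lift g.1) := by
    ext i; simp [hσ]
  change σ (FreeGroup.lift g.1 _) = FreeGroup.lift h.1 _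
  rw [e]; rfl

theorem act_conj (x : FreeGroup (Fin n)) (g : GenTuple n G) : act (MulAut.conj x) g ≈ g := by
  refine ⟨MulAut.conj (FreeGroup.lift g.1 x), fun i => ?_⟩
  change MulAut.conj _ (FreeGroup.lift g.1 ((MulAut.conj x)⁻¹ (FreeGroup.of i))) = _
  simp [mul_assoc]

end GenTuple

/-- `\bar V_n(G)`, the set of `Aut(G)`-classes of generating `n`-tuples of `G`. -/
def GenTupleClass (n : ℕ) (G : Type*) [Group G] : Type _ := Quotient (GenTuple.setoid n G)

namespace GenTupleClass

variable {n : ℕ} {G : Type*} [Group G]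

/-- The class `[g]` of a generating tuple. -/
def mk (g : GenTuple n G) : GenTupleClass n G := Quotient.mk _ g

/-- The induced action of `α ∈ Aut(F_n)` on `\bar V_n(G)`. -/
def act (α : MulAut (FreeGroup (Fin n))) : GenTupleClass n G → GenTupleClass n G :=
  Quotient.map (GenTuple.act α) (fun _ _ h => GenTuple.act_equiv α h)

theorem act_one (x : GenTupleClass n G) : act 1 x = x := by
  induction x using Quotient.inductionOn with
  | _ g => exact congrArg (Quotient.mk _) (GenTuple.act_one g)

theorem act_mul (α β : MulAut (FreeGroup (Fin n))) (x : GenTupleClass n G) :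
    act (α * β) x = act α (act β x) := by
  induction x using Quotient.inductionOn with
  | _ g => exact congrArg (Quotient.mk _) (GenTuple.act_mul α β g)

theorem act_inner {α : MulAut (FreeGroup (Fin n))} (hα : α ∈ Inn (FreeGroup (Fin n)))
    (x : GenTupleClass n G) : act α x = x := by
  obtain ⟨y, rfl⟩ := hα
  induction x using Quotient.inductionOn with
  | _ g => exact Quotient.sound (GenTuple.act_conj y g)

/-- The action of `Out(F_n)` on `\bar V_n(G)`, induced by that of `Aut(F_n)`. -/
instance : MulAction (Out (FreeGroup (Fin n))) (GenTupleClass n G) where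
  smul γ x := Quotient.liftOn' γ (fun α => act α x) (by
    intro α β h
    have h' : α⁻¹ * β ∈ Inn (FreeGroup (Fin n)) := QuotientGroup.leftRel_apply.1 h
    change act α x = act β x
    rw [← mul_inv_cancel_left α β, act_mul, act_inner h'])
  one_smul x := act_one x
  mul_smul γ δ x := by
    induction γ using QuotientGroup.induction_on with
    | _ α =>
      induction δ using QuotientGroup.induction_on with
      | _ β => exact act_mul α β x

theorem smul_mk (α : MulAut (FreeGroup (Fin n))) (g : GenTuple n G) :
    (QuotientGroup.mk α : Out (FreeGroup (Fin n))) • mk g = mk (GenTuple.act α g) := rfl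

end GenTupleClass

/-!
**High transitivity.** Two elements of `G` that do not commute generate `G`. Fix such `a`, `b`.
All tuples `(a, b, c, 1, …, 1)` generate `G`, and they are pairwise inequivalent. By induction it
suffices to move a generating tuple `y`, not equivalent to any `(a, b, c, 1, …, 1)` with `c` in a
finite set `S`, to `(a, b, c', 1, …, 1)` with `c' ∉ S`, by an automorphism that fixes the tuples
`(a, b, c, 1, …, 1)`, `c ∈ S` (`IsTarskiMonster.exists_smul_eq_stdClass`). If the first three
entries of `y` generate `G` and are not equivalent to `(a, b, c)` for `c ∈ S`, then Hall's
commutator argument (`IsTarskiMonster.map_iInf_ker_eq_top`) gives words in `x_1, x_2, x_3` that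
are trivial on the fixed tuples and arbitrary on `y`. So `y_4` may be made arbitrary, and as the
fixed tuples have fourth entry `1`, it may be used to change each of `y_1, y_2, y_3`
(`IsTarskiMonster.exists_reach_update`). Since `G` is infinite and, by B. H. Neumann's lemma, not
a union of two proper subgroups and a finite set, generic choices lead to the target. The
assumption on the first three entries is arranged by multiplying them by conjugates of later
entries (`IsTarskiMonster.exists_reach_isGood`).

**A law gives a kernel.** If `w` is a nontrivial law in `x_1, x_2`, then `x_3 ↦ x_3 w` acts
trivially. It is not inner since inner automorphisms preserve the normal closure of `x_3`.

**Without laws the action is faithful.** Let `N` be the kernel of the action of `Aut(F_n)`. As `G`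
has no law, every nontrivial word in `n - 1` letters is nontrivial on some generating tuple of
length `n - 1`. So each `α ∈ N` preserves the kernel of each retraction `x_j ↦ u ∈ ⟨x_i, i ≠ j⟩`
(`IsTarskiMonster.preservesRetractKernels`), and `FreeGroup.le_Inn_of_preservesRetractKernels`
concludes. To see that `α x_i` is conjugate to `x_i ^ ±1`, use the retractions `ψ : x_j ↦ x_l ^ M
x_i ^ k x_l ^ M` with `k` large: `ψ (α x_i)` has a `k`-th power in which the number of letters
other than `x_i` is bounded independently of `k`, so it is conjugate into `⟨x_i⟩`, whereas an
occurrence of `x_j` in the cyclic reduction of `α x_i` would survive in all powers of `ψ (α x_i)`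
by the big powers property (`FreeGroup.lenOff_prod_mul_zpow`). As `N` is normal, all primitive
elements are mapped to conjugates of themselves or their inverses. Applying this to `x_j x_i ^ m`
shows that, up to an inner automorphism, `α x_i = x_i ^ ±1` for all `i`, and retractions killing
`x_i x_j` and `x_i x_j x_l` show that all signs are `+1`.
-/

/-! ### Reduced words and the big powers property -/

namespace FreeGroup

variable {ι : Type*}

theorem exists_zpow_of_forall_fst_eq {i : ι} {L : List (ι × Bool)} (h : ∀ a ∈ L, a.1 = i) :
    ∃ p : ℤ, p.natAbs ≤ L.length ∧ mk L = of i ^ p := by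
  induction L with
  | nil => exact ⟨0, by simp, by simp [← one_eq_mk]⟩
  | cons a L ih =>
    obtain ⟨p, hp, hL⟩ := ih fun b hb => h b (List.mem_cons_of_mem _ hb)
    obtain ⟨j, s⟩ := a
    obtain rfl : j = i := h _ List.mem_cons_self
    have e : mk ((j, s) :: L) = mk [(j, s)] * mk L := by simp [mul_mk]
    cases s
    · refine ⟨-1 + p, by simp; omega, ?_⟩
      rw [e, hL, zpow_add, zpow_neg_one]; rfl
    · refine ⟨1 + p, by simp; omega, ?_⟩
      rw [e, hL, zpow_add, zpow_one]; rfl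

/-- The reduced word of `x_i ^ p`. -/
def powWord (i : ι) (p : ℤ) : List (ι × Bool) := List.replicate p.natAbs (i, decide (0 ≤ p))

theorem mk_powWord (i : ι) (p : ℤ) : mk (powWord i p) = of i ^ p := by
  have key : ∀ (n : ℕ) (s : Bool), mk (List.replicate n (i, s)) = mk [(i, s)] ^ n := by
    intro n s
    induction n with
    | zero => simp [← one_eq_mk]
    | succ n ih => rw [pow_succ', ← ih, List.replicate_succ, mul_mk]; rfl
  rw [powWord, key]
  obtain ⟨n, rfl | rfl⟩ := p.eq_nat_or_neg
  · simp only [Int.natCast_nonneg, decide_true, Int.natAbs_natCast, zpow_natCast]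
    rfl
  · cases n with
    | zero => simp
    | succ n =>
      have : ¬ (0 : ℤ) ≤ -((n + 1 : ℕ) : ℤ) := by omega
      simp only [this, decide_false, Int.natAbs_neg, Int.natAbs_natCast, zpow_neg, zpow_natCast]
      rw [← inv_pow]; rfl

theorem fst_eq_of_mem_powWord {i : ι} {p : ℤ} {a : ι × Bool} (h : a ∈ powWord i p) : a.1 = i := by
  rw [powWord, List.mem_replicate] at h
  rw [h.2]

theorem isReduced_powWord (i : ι) (p : ℤ) : IsReduced (powWord i p) :=
  List.isChain_replicate_of_rel _ fun _ => rfl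

theorem powWord_ne_nil {i : ι} {p : ℤ} (hp : p ≠ 0) : powWord i p ≠ [] := by
  simpa [powWord] using hp

/-- Words that neither end nor begin in `x_i` may be joined by a nonzero power of `x_i`. -/
theorem IsReduced.append_powWord_append {i : ι} {A L : List (ι × Bool)} {p : ℤ}
    (hA : IsReduced A) (hL : IsReduced L) (hA' : ∀ a ∈ A.getLast?, a.1 ≠ i)
    (hL' : ∀ a ∈ L.head?, a.1 ≠ i) (hp : A = [] ∨ p ≠ 0) :
    IsReduced (A ++ powWord i p ++ L) := by
  have h1 : IsReduced (powWord i p ++ L) := by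
    refine List.isChain_append.2 ⟨isReduced_powWord i p, hL, fun x hx y hy hxy => ?_⟩
    have := fst_eq_of_mem_powWord (List.mem_of_mem_getLast? hx)
    exact absurd (hxy.symm.trans this) (hL' y hy)
  rcases hp with rfl | hp
  · simpa using h1
  · refine IsReduced.append_overlap ?_ h1 (powWord_ne_nil hp)
    refine List.isChain_append.2 ⟨hA, isReduced_powWord i p, fun x hx y hy hxy => ?_⟩
    have := fst_eq_of_mem_powWord (List.mem_of_mem_head? hy)
    exact absurd (hxy.trans this) (hA' x hx)

variable [DecidableEq ι]

/-- The number of letters other than `x_i` and `x_i⁻¹` in the reduced word of `g`. -/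
def lenOff (i : ι) (g : FreeGroup ι) : ℕ := g.toWord.countP fun a => a.1 ≠ i

theorem lenOff_mk {i : ι} {L : List (ι × Bool)} (h : IsReduced L) :
    lenOff i (mk L) = L.countP fun a => a.1 ≠ i := by
  rw [lenOff, toWord_mk, h.reduce_eq]

theorem lenOff_mk_le (i : ι) (L : List (ι × Bool)) :
    lenOff i (mk L) ≤ L.countP fun a => a.1 ≠ i := by
  rw [lenOff, toWord_mk]
  exact (Red.sublist reduce.red).countP_le

@[simp] theorem lenOff_one (i : ι) : lenOff i 1 = 0 := by simp [lenOff]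

theorem lenOff_mul_le (i : ι) (g h : FreeGroup ι) : lenOff i (g * h) ≤ lenOff i g + lenOff i h := by
  rw [lenOff, lenOff, lenOff, ← List.countP_append]
  exact (toWord_mul_sublist g h).countP_le

@[simp] theorem lenOff_inv (i : ι) (g : FreeGroup ι) : lenOff i g⁻¹ = lenOff i g := by
  rw [lenOff, lenOff, toWord_inv, invRev, List.countP_reverse, List.countP_map]
  rfl

@[simp] theorem lenOff_of_zpow_self (i : ι) (p : ℤ) : lenOff i (of i ^ p) = 0 := by
  rw [← mk_powWord, lenOff_mk (isReduced_powWord i p), List.countP_eq_zero]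
  intro a ha
  simp [fst_eq_of_mem_powWord ha]

theorem lenOff_le_norm (i : ι) (g : FreeGroup ι) : lenOff i g ≤ norm g := List.countP_le_length

theorem lenOff_pow_le (i : ι) (g : FreeGroup ι) (m : ℕ) : lenOff i (g ^ m) ≤ m * lenOff i g := by
  induction m with
  | zero => simp
  | succ m ih =>
    rw [pow_succ, add_mul, one_mul]
    exact (lenOff_mul_le _ _ _).trans (by omega)

theorem lenOff_conj_le (i : ι) (c g : FreeGroup ι) :
    lenOff i (c * g * c⁻¹) ≤ lenOff i g + 2 * lenOff i c := by
  have h1 := lenOff_mul_le i (c * g) c⁻¹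
  have h2 := lenOff_mul_le i c g
  rw [lenOff_inv] at h1
  omega

/-- Under an endomorphism that lengthens each generator by a bounded amount, lengths grow at most
linearly. -/
theorem lenOff_lift_le {κ : Type*} [DecidableEq κ] (i : ι) {f : κ → FreeGroup ι} {C : ℕ}
    (hf : ∀ j, lenOff i (f j) ≤ C) (g : FreeGroup κ) : lenOff i (lift f g) ≤ norm g * C := by
  conv_lhs => rw [← mk_toWord (x := g)]
  rw [norm]
  induction g.toWord with
  | nil => simp [← one_eq_mk]
  | cons a L ih =>
    have e : (mk (a :: L) : FreeGroup κ) = mk [a] * mk L := by simp [mul_mk]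
    rw [e, _root_.map_mul, List.length_cons, add_mul, one_mul, add_comm]
    refine (lenOff_mul_le _ _ _).trans (Nat.add_le_add ?_ ih)
    obtain ⟨j, s⟩ := a
    cases s <;> simpa using hf j

/-- An element outside `⟨x_i⟩` is `x_i ^ p * u * x_i ^ q` where the reduced word `u` is nonempty and
neither begins nor ends in `x_i`. -/
theorem exists_eq_zpow_mul_mk_mul_zpow {i : ι} {g : FreeGroup ι}
    (hg : g ∉ Subgroup.zpowers (of i)) :
    ∃ (p q : ℤ) (L : List (ι × Bool)), p.natAbs ≤ norm g ∧ q.natAbs ≤ norm g ∧ L ≠ [] ∧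
      IsReduced L ∧ (∀ a ∈ L.head?, a.1 ≠ i) ∧ (∀ a ∈ L.getLast?, a.1 ≠ i) ∧
      g = of i ^ p * mk L * of i ^ q ∧ lenOff i g = L.countP fun a => a.1 ≠ i := by
  set T := g.toWord.takeWhile (fun a => a.1 = i) with hT
  set D := g.toWord.dropWhile (fun a => a.1 = i) with hD
  set E := D.rdropWhile (fun a => a.1 = i) with hE
  set R := D.rtakeWhile (fun a => a.1 = i) with hR
  have hW : g.toWord = T ++ (E ++ R) := by
    rw [hE, hR, List.rdropWhile_append_rtakeWhile, hT, hD, List.takeWhile_append_dropWhile]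
  have hTi : ∀ a ∈ T, a.1 = i := fun a ha => by simpa using List.mem_takeWhile_imp ha
  have hRi : ∀ a ∈ R, a.1 = i := fun a ha => by simpa using List.mem_rtakeWhile_imp ha
  obtain ⟨p, hp, hTp⟩ := exists_zpow_of_forall_fst_eq hTi
  obtain ⟨q, hq, hRq⟩ := exists_zpow_of_forall_fst_eq hRi
  have hgE : g = of i ^ p * mk E * of i ^ q := by
    rw [← hTp, ← hRq, mul_mk, mul_mk, List.append_assoc, ← hW, mk_toWord]
  have hlen : norm g = T.length + (E.length + R.length) := by
    rw [norm, hW, List.length_append, List.length_append]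
  have hE0 : E ≠ [] := by
    intro h0
    apply hg
    rw [hgE, h0, ← one_eq_mk, mul_one, ← zpow_add]
    exact Subgroup.zpow_mem_zpowers _ _
  refine ⟨p, q, E, by omega, by omega, hE0,
    (isReduced_toWord (x := g)).infix ⟨T, R, by simp [hW]⟩, ?_, ?_,
    hgE, ?_⟩
  · intro a ha
    have hpre : E <+: D := List.rdropWhile_prefix _ _
    have hD0 : D ≠ [] := fun h0 => hE0 (by simpa [h0] using hpre)
    have h1 : D.head? = some a := by
      obtain ⟨t, ht⟩ := hpre
      rw [← ht, List.head?_append]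
      rw [Option.mem_def] at ha
      simp [ha]
    have h2 : decide ((D.head hD0).1 = i) = false := List.head_dropWhile_not _ hD0
    rw [List.head?_eq_some_head hD0] at h1
    have h3 : D.head hD0 = a := Option.some.inj h1
    rw [h3] at h2
    simpa using h2
  · intro a ha
    rw [List.getLast?_eq_some_getLast hE0, Option.mem_some_iff] at ha
    have h2 := List.rdropWhile_last_not (fun a : ι × Bool => decide (a.1 = i)) D hE0
    rw [← ha]
    simpa using h2
  · rw [lenOff, hW, List.countP_append, List.countP_append]
    have h1 : T.countP (fun a => a.1 ≠ i) = 0 :=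
      List.countP_eq_zero.2 fun a ha => by simp [hTi a ha]
    have h2 : R.countP (fun a => a.1 ≠ i) = 0 :=
      List.countP_eq_zero.2 fun a ha => by simp [hRi a ha]
    omega

theorem lenOff_pos {i : ι} {g : FreeGroup ι} (hg : g ∉ Subgroup.zpowers (of i)) :
    0 < lenOff i g := by
  obtain ⟨p, q, L, -, -, hL0, -, hhead, -, -, hcount⟩ := exists_eq_zpow_mul_mk_mul_zpow hg
  rw [hcount, List.countP_pos_iff]
  exact ⟨L.head hL0, List.head_mem hL0, by simpa using hhead _ (List.head_mem_head? hL0)⟩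

/-- The big powers property: in a product of elements `z ∉ ⟨x_i⟩` separated by large powers of
`x_i`, only powers of `x_i` cancel. -/
theorem lenOff_prod_mul_zpow {i : ι} {B : ℕ} {ps : List (FreeGroup ι × ℤ)}
    (h : ∀ p ∈ ps, p.1 ∉ Subgroup.zpowers (of i) ∧ norm p.1 ≤ B ∧ 2 * B < p.2.natAbs) :
    lenOff i (ps.map fun p => p.1 * of i ^ p.2).prod = (ps.map fun p => lenOff i p.1).sum := by
  suffices H : ∃ (A : List (ι × Bool)) (r : ℤ), IsReduced A ∧ (∀ a ∈ A.getLast?, a.1 ≠ i) ∧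
      (A = [] ∨ B < r.natAbs) ∧ (A.countP fun a => a.1 ≠ i) = (ps.map fun p => lenOff i p.1).sum ∧
      (ps.map fun p => p.1 * of i ^ p.2).prod = mk A * of i ^ r by
    obtain ⟨A, r, hA, hlast, -, hcount, hprod⟩ := H
    have e : mk A * of i ^ r = mk (A ++ powWord i r) := by rw [← mul_mk, mk_powWord]
    have hred : IsReduced (A ++ powWord i r) := by
      by_cases hr : r = 0
      · simpa [hr, powWord] using hA
      · simpa using hA.append_powWord_append IsReduced.nil hlast (by simp) (Or.inr hr)
    have h0 : (powWord i r).countP (fun a => a.1 ≠ i) = 0 :=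
      List.countP_eq_zero.2 fun a ha => by simp [fst_eq_of_mem_powWord ha]
    rw [hprod, e, lenOff_mk hred, List.countP_append, h0, hcount, add_zero]
  induction ps using List.reverseRecOn with
  | nil => exact ⟨[], 0, by simp [← one_eq_mk]⟩
  | append_singleton ps p ih =>
    obtain ⟨A, r, hA, hlast, hr, hcount, hprod⟩ := ih fun p hp => h p (by simp [hp])
    obtain ⟨hz, hzB, hk⟩ := h p (by simp)
    obtain ⟨s, t, L, hs, ht, hL0, hL, hhead, hlast', hzL, hzcount⟩ :=
      exists_eq_zpow_mul_mk_mul_zpow hz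
    have hr' : A = [] ∨ r + s ≠ 0 := hr.imp id fun _ => by omega
    refine ⟨A ++ powWord i (r + s) ++ L, t + p.2,
      hA.append_powWord_append hL hlast hhead hr', ?_, Or.inr (by omega), ?_, ?_⟩
    · intro a ha
      rw [List.getLast?_append_of_ne_nil _ hL0] at ha
      exact hlast' a ha
    · have h0 : (powWord i (r + s)).countP (fun a => a.1 ≠ i) = 0 :=
        List.countP_eq_zero.2 fun a ha => by simp [fst_eq_of_mem_powWord ha]
      rw [List.countP_append, List.countP_append, h0, hcount, List.map_append, List.sum_append,
        ← hzcount]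
      simp
    · rw [List.map_append, List.prod_append, hprod, ← mul_mk, ← mul_mk, mk_powWord]
      simp only [List.map_cons, List.map_nil, List.prod_singleton]
      nth_rw 1 [hzL]
      rw [zpow_add, zpow_add]
      group

/-- If the powers of `g` contain few letters other than `x_i`, then `g` is conjugate into
`⟨x_i⟩`. -/
theorem exists_conj_zpow_of_lenOff_pow_lt {i : ι} {g : FreeGroup ι} {k : ℕ}
    (h : lenOff i (g ^ k) < k) : ∃ (c : FreeGroup ι) (e : ℤ), g = c * of i ^ e * c⁻¹ := by
  have hk : k ≠ 0 := by omega
  have hred : IsReduced g.toWord := isReduced_toWord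
  set V := reduceCyclically g.toWord with hV
  have hconj : g = mk (reduceCyclically.conjugator g.toWord) * mk V *
      (mk (reduceCyclically.conjugator g.toWord))⁻¹ := by
    rw [inv_mk, mul_mk, mul_mk, reduceCyclically.conj_conjugator_reduceCyclically, mk_toWord]
  have hVi : ∀ a ∈ V, a.1 = i := by
    by_contra! hcon
    obtain ⟨a, ha, hai⟩ := hcon
    have h1 : 1 ≤ V.countP (fun a => a.1 ≠ i) :=
      List.one_le_countP_iff.2 ⟨a, ha, by simpa using hai⟩
    rw [lenOff, toWord_pow, reduceCyclically.reduce_flatten_replicate hred, if_neg hk,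
      List.countP_append, List.countP_append, List.countP_flatten, List.map_replicate,
      List.sum_replicate, smul_eq_mul, ← hV] at h
    nlinarith
  obtain ⟨e, -, he⟩ := exists_zpow_of_forall_fst_eq hVi
  exact ⟨_, e, by rw [← he]; exact hconj⟩

end FreeGroup

/-! ### Automorphisms that preserve the kernels of retractions -/

namespace FreeGroup

variable {ι : Type*}

/-- The subgroup generated by the free generators other than `x_j`. -/
def others (j : ι) : Subgroup (FreeGroup ι) := Subgroup.closure (of '' {j}ᶜ)

theorem of_mem_others {i j : ι} (h : i ≠ j) : of i ∈ others j :=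
  Subgroup.subset_closure ⟨i, h, rfl⟩

/-- The sign of a letter. -/
def sgn (s : Bool) : ℤ := if s then 1 else -1

theorem zpow_sgn_eq (i l : ι) (M k : ℤ) (s : Bool) :
    (of l ^ M * of i ^ k * of l ^ M) ^ sgn s =
      of l ^ (sgn s * M) * of i ^ (sgn s * k) * of l ^ (sgn s * M) := by
  cases s
  · rw [sgn, if_neg Bool.false_ne_true, zpow_neg_one, neg_one_mul, neg_one_mul, zpow_neg, zpow_neg]
    group
  · simp [sgn]

variable [DecidableEq ι]

/-- The exponent sum of `x_l`. -/
def expSum (l : ι) : FreeGroup ι →* Multiplicative ℤ :=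
  lift fun j => Multiplicative.ofAdd (if j = l then 1 else 0)

theorem expSum_of (l j : ι) : expSum l (of j) = Multiplicative.ofAdd (if j = l then 1 else 0) := by
  simp [expSum]

theorem toAdd_expSum_of_zpow (l j : ι) (p : ℤ) :
    (expSum l (of j ^ p)).toAdd = if j = l then p else 0 := by
  rw [map_zpow, expSum_of]
  split_ifs <;> simp

theorem natAbs_expSum_mk_le (l : ι) (Y : List (ι × Bool)) :
    (expSum l (mk Y)).toAdd.natAbs ≤ Y.length := by
  induction Y with
  | nil => simp [← one_eq_mk]
  | cons a Y ih =>
    have e : (mk (a :: Y) : FreeGroup ι) = mk [a] * mk Y := by simp [mul_mk]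
    have h1 : (expSum l (mk [a])).toAdd.natAbs ≤ 1 := by
      obtain ⟨j, s⟩ := a
      cases s
      · have e' : (mk [(j, false)] : FreeGroup ι) = of j ^ (-1 : ℤ) := by rw [zpow_neg_one]; rfl
        rw [e', toAdd_expSum_of_zpow]
        split_ifs <;> simp
      · have e' : (mk [(j, true)] : FreeGroup ι) = of j ^ (1 : ℤ) := by rw [zpow_one]; rfl
        rw [e', toAdd_expSum_of_zpow]
        split_ifs <;> simp
    rw [e, _root_.map_mul, toAdd_mul, List.length_cons]
    omega

theorem lenOff_of_zpow_le (i j : ι) (p : ℤ) : lenOff i (of j ^ p) ≤ p.natAbs := by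
  rw [← mk_powWord]
  refine (lenOff_mk_le _ _).trans (List.countP_le_length.trans ?_)
  simp [powWord]

theorem norm_of_zpow_le (j : ι) (p : ℤ) : norm (of j ^ p) ≤ p.natAbs := by
  rw [← mk_powWord]
  refine norm_mk_le.trans ?_
  simp [powWord]

/-- The endomorphism of the free group that sends `x_j` to `u` and fixes the other generators. -/
def retract (j : ι) (u : FreeGroup ι) : FreeGroup ι →* FreeGroup ι := lift (Function.update of j u)

@[simp] theorem retract_self (j : ι) (u : FreeGroup ι) : retract j u (of j) = u := by
  simp [retract]

theorem retract_of_ne {i j : ι} (h : i ≠ j) (u : FreeGroup ι) : retract j u (of i) = of i := by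
  simp [retract, h]

theorem retract_mk_eq_self {j : ι} (u : FreeGroup ι) {Y : List (ι × Bool)} (h : ∀ a ∈ Y, a.1 ≠ j) :
    retract j u (mk Y) = mk Y := by
  induction Y with
  | nil => simp [← one_eq_mk]
  | cons a Y ih =>
    have e : (mk (a :: Y) : FreeGroup ι) = mk [a] * mk Y := by simp [mul_mk]
    rw [e, _root_.map_mul, ih fun b hb => h b (List.mem_cons_of_mem _ hb)]
    congr 1
    have ha := h a List.mem_cons_self
    obtain ⟨l, s⟩ := a
    cases s
    · have e' : (mk [(l, false)] : FreeGroup ι) = (of l)⁻¹ := rfl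
      rw [e', _root_.map_inv, retract_of_ne ha]
    · exact retract_of_ne ha u

/-- `α` maps the kernel of each retraction `x_j ↦ u ∈ ⟨x_i, i ≠ j⟩` into itself. -/
def PreservesRetractKernels (α : MulAut (FreeGroup ι)) : Prop :=
  ∀ (j : ι) (u : FreeGroup ι), u ∈ others j → ∀ v, retract j u v = 1 → retract j u (α v) = 1

/-- The image of `x_i` under `x_j ↦ x_l ^ M x_i ^ k x_l ^ M` following `α` is conjugate into `⟨x_i⟩`
for large `k`: it is a `k`-th root of the image of `α (x_l ^ -M x_j x_l ^ -M)`, in which the number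
of letters other than `x_i` does not depend on `k`. -/
theorem PreservesRetractKernels.exists_retract_eq_conj {α : MulAut (FreeGroup ι)}
    (hα : PreservesRetractKernels α) {i j l : ι} (hij : i ≠ j) (hlj : l ≠ j) (M : ℕ) :
    ∃ K : ℕ, ∀ k : ℕ, K < k → ∃ (c : FreeGroup ι) (e : ℤ),
      retract j (of l ^ (M : ℤ) * of i ^ (k : ℤ) * of l ^ (M : ℤ)) (α (of i)) =
        c * of i ^ e * c⁻¹ := by
  set y : FreeGroup ι := of l ^ (-M : ℤ) * of j * of l ^ (-M : ℤ) with hy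
  refine ⟨norm (α y) * (2 * M + 1), fun k hk => ?_⟩
  set u : FreeGroup ι := of l ^ (M : ℤ) * of i ^ (k : ℤ) * of l ^ (M : ℤ) with hu
  have hu' : u ∈ others j := by
    have h1 := zpow_mem (of_mem_others hlj) (M : ℤ)
    have h2 := zpow_mem (of_mem_others hij) (k : ℤ)
    exact mul_mem (mul_mem h1 h2) h1
  have hroot : retract j u (α y) = retract j u (α (of i)) ^ k := by
    have h1 : retract j u (y * of i ^ (-k : ℤ)) = 1 := by
      simp only [hy, _root_.map_mul, map_zpow, retract_self, retract_of_ne hlj,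
        retract_of_ne hij, hu]
      group
    have h2 := hα j u hu' _ h1
    rw [_root_.map_mul, _root_.map_mul, zpow_neg, _root_.map_inv, _root_.map_inv,
      mul_inv_eq_one] at h2
    rw [h2]
    simp
  apply exists_conj_zpow_of_lenOff_pow_lt (k := k)
  rw [← hroot]
  refine lt_of_le_of_lt (lenOff_lift_le i (C := 2 * M + 1) ?_ _) hk
  intro m
  by_cases hm : m = j
  · subst hm
    have h1 := lenOff_mul_le i (of l ^ (M : ℤ) * of i ^ (k : ℤ)) (of l ^ (M : ℤ))
    have h2 := lenOff_mul_le i (of l ^ (M : ℤ)) (of i ^ (k : ℤ))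
    have h3 := lenOff_of_zpow_le i l M
    have h4 := lenOff_of_zpow_self i (k : ℤ)
    rw [Function.update_self, hu]
    rw [Int.natAbs_natCast] at h3
    omega
  · rw [Function.update_of_ne hm]
    have := lenOff_of_zpow_le i m 1
    simp at this
    omega

theorem lenOff_zpow_mul_zpow_mul_zpow {i l : ι} (hil : i ≠ l) {p : ℤ} (hp : p ≠ 0) (a b : ℤ) :
    lenOff i (of l ^ a * of i ^ p * of l ^ b) = a.natAbs + b.natAbs := by
  have hne : ∀ (q : ℤ), ∀ a ∈ powWord l q, a.1 ≠ i := fun q a ha => by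
    rw [fst_eq_of_mem_powWord ha]; exact hil.symm
  have hcount : ∀ q : ℤ, (powWord l q).countP (fun a => a.1 ≠ i) = q.natAbs := fun q => by
    rw [List.countP_eq_length.2 (fun a ha => by simpa using hne q a ha), powWord,
      List.length_replicate]
  have hred : IsReduced (powWord l a ++ powWord i p ++ powWord l b) :=
    (isReduced_powWord _ _).append_powWord_append (isReduced_powWord _ _)
      (fun a ha => hne _ a (List.mem_of_mem_getLast? ha))
      (fun a ha => hne _ a (List.mem_of_mem_head? ha)) (Or.inr hp)
  have h0 : (powWord i p).countP (fun a => a.1 ≠ i) = 0 :=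
    List.countP_eq_zero.2 fun a ha => by simp [fst_eq_of_mem_powWord ha]
  rw [← mk_powWord, ← mk_powWord, ← mk_powWord, mul_mk, mul_mk, lenOff_mk hred, List.countP_append,
    List.countP_append, hcount, hcount, h0, add_zero]

/-- Between two large powers of `x_l`, a short reduced word gives an element outside `⟨x_i⟩`, unless
everything cancels. -/
theorem zpow_mul_mk_mul_zpow_notMem_zpowers {i l : ι} (hil : i ≠ l) {M : ℕ} {Y : List (ι × Bool)}
    (hY : IsReduced Y) (hM : Y.length < M) {s t : Bool} (hst : Y = [] → s = t) :
    of l ^ (sgn s * M) * mk Y * of l ^ (sgn t * M) ∉ Subgroup.zpowers (of i) := by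
  intro hmem
  obtain ⟨p, hp⟩ := Subgroup.mem_zpowers_iff.1 hmem
  by_cases h : s = t
  · subst h
    have h1 := congrArg (fun g => (expSum l g).toAdd) hp
    simp only [_root_.map_mul, toAdd_mul, toAdd_expSum_of_zpow, if_neg hil, if_true] at h1
    have h2 := natAbs_expSum_mk_le l Y
    cases s <;> simp only [sgn] at h1 <;> simp at h1 <;> omega
  · have hts : sgn t = - sgn s := by cases s <;> cases t <;> simp_all [sgn]
    have hYne : Y ≠ [] := fun h0 => h (hst h0)
    have hYeq : mk Y = of l ^ (-(sgn s * M)) * of i ^ p * of l ^ (sgn s * M) := by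
      rw [hp, hts]
      group
    by_cases hp0 : p = 0
    · rw [hp0, zpow_zero, mul_one, ← zpow_add, neg_add_cancel, zpow_zero] at hYeq
      apply hYne
      rw [← hY.reduce_eq, ← toWord_mk, hYeq, toWord_one]
    · have hsM : (sgn s * M).natAbs = M := by cases s <;> simp [sgn]
      have h1 := lenOff_zpow_mul_zpow_mul_zpow hil hp0 (-(sgn s * M)) (sgn s * M)
      have h2 := (lenOff_le_norm i (mk Y)).trans norm_mk_le
      rw [← hYeq, Int.natAbs_neg, hsM] at h1
      omega

theorem retract_mk_singleton_self (j : ι) (u : FreeGroup ι) (s : Bool) :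
    retract j u (mk [(j, s)]) = u ^ sgn s := by
  cases s
  · have e' : (mk [(j, false)] : FreeGroup ι) = (of j)⁻¹ := rfl
    rw [e', _root_.map_inv, retract_self]
    simp [sgn]
  · have e' : (mk [(j, true)] : FreeGroup ι) = of j := rfl
    rw [e', retract_self]
    simp [sgn]

/-- Substituting `x_l ^ M x_i ^ k x_l ^ M` for `x_j` in a word turns each occurrence of `x_j` into a
large power of `x_i`, and the segments between them into elements outside `⟨x_i⟩`. -/
theorem exists_retract_mk_eq_prod {i j l : ι} (hil : i ≠ l) {M k : ℕ} (s₀ s : Bool)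
    (W Y : List (ι × Bool)) (hred : IsReduced ((j, s₀) :: (Y ++ W ++ [(j, s)])))
    (hY : ∀ a ∈ Y, a.1 ≠ j) (hM : Y.length + W.length < M) :
    ∃ ps : List (FreeGroup ι × ℤ), ps ≠ [] ∧
      (∀ p ∈ ps, p.1 ∉ Subgroup.zpowers (of i) ∧ norm p.1 ≤ 3 * M ∧ p.2.natAbs = k) ∧
      of l ^ (sgn s₀ * M) *
          retract j (of l ^ (M : ℤ) * of i ^ (k : ℤ) * of l ^ (M : ℤ)) (mk (Y ++ W ++ [(j, s)])) =
        (ps.map fun p => p.1 * of i ^ p.2).prod * of l ^ (sgn s * M) := by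
  have hsM : ∀ s : Bool, (sgn s * (M : ℤ)).natAbs = M := fun s => by cases s <;> simp [sgn]
  have hsk : ∀ s : Bool, (sgn s * (k : ℤ)).natAbs = k := fun s => by cases s <;> simp [sgn]
  have hnorm : ∀ (Y : List (ι × Bool)) (s t : Bool), Y.length < M →
      norm (of l ^ (sgn s * M) * mk Y * of l ^ (sgn t * M)) ≤ 3 * M := by
    intro Y s t hY
    have h1 := norm_mul_le (of l ^ (sgn s * M) * mk Y) (of l ^ (sgn t * M))
    have h2 := norm_mul_le (of l ^ (sgn s * M)) (mk Y)
    have h3 := norm_of_zpow_le l (sgn s * M)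
    have h4 := norm_of_zpow_le l (sgn t * M)
    have h5 : norm (mk Y) ≤ Y.length := norm_mk_le
    rw [hsM] at h3 h4
    omega
  have hend : ∀ (s₀ s : Bool) (Y Z : List (ι × Bool)), IsReduced ((j, s₀) :: (Y ++ (j, s) :: Z)) →
      (Y = [] → s₀ = s) := by
    rintro s₀ s _ Z hr rfl
    rw [List.nil_append, isReduced_cons_cons] at hr
    exact hr.1 rfl
  induction W generalizing Y s₀ with
  | nil =>
    simp only [List.append_nil, List.length_nil, add_zero] at hred hM ⊢
    refine ⟨[(of l ^ (sgn s₀ * M) * mk Y * of l ^ (sgn s * M), sgn s * k)], by simp, ?_, ?_⟩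
    · intro p hp
      rw [List.mem_singleton] at hp
      subst hp
      refine ⟨zpow_mul_mk_mul_zpow_notMem_zpowers hil (hred.infix ⟨[(j, s₀)], [(j, s)], by simp⟩) hM
        (hend s₀ s Y [] hred), hnorm Y s₀ s hM, hsk s⟩
    · rw [← mul_mk, _root_.map_mul, retract_mk_eq_self _ hY, retract_mk_singleton_self, zpow_sgn_eq]
      simp [mul_assoc]
  | cons a W ih =>
    rw [List.length_cons] at hM
    by_cases ha : a.1 = j
    · obtain ⟨m, t⟩ := a
      obtain rfl : m = j := ha
      have hred' : IsReduced ((m, t) :: ([] ++ W ++ [(m, s)])) :=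
        hred.infix ⟨(m, s₀) :: Y, [], by simp⟩
      obtain ⟨ps, -, hps, hprod⟩ := ih t [] hred' (by simp) (by simp; omega)
      refine ⟨(of l ^ (sgn s₀ * M) * mk Y * of l ^ (sgn t * M), sgn t * k) :: ps, by simp, ?_, ?_⟩
      · intro p hp
        rcases List.mem_cons.1 hp with rfl | hp
        · refine ⟨zpow_mul_mk_mul_zpow_notMem_zpowers hil
            (hred.infix ⟨[(m, s₀)], (m, t) :: W ++ [(m, s)], by simp⟩) (by omega)
            (hend s₀ t Y (W ++ [(m, s)]) (by simpa using hred)), hnorm Y s₀ t (by omega), hsk t⟩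
        · exact hps p hp
      · have e : (mk (Y ++ (m, t) :: W ++ [(m, s)]) : FreeGroup ι) =
            mk Y * mk [(m, t)] * mk ([] ++ W ++ [(m, s)]) := by simp [mul_mk]
        rw [e, _root_.map_mul, _root_.map_mul, retract_mk_eq_self _ hY, retract_mk_singleton_self,
          zpow_sgn_eq, List.map_cons, List.prod_cons, mul_assoc (_ * _) _ (of l ^ (sgn s * M)),
          ← hprod]
        simp only [mul_assoc]
    · have := ih s₀ (Y ++ [a]) (by simpa using hred)
        (by
          intro b hb
          rcases List.mem_append.1 hb with hb | hb
          · exact hY b hb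
          · rw [List.mem_singleton.1 hb]; exact ha)
        (by simp; omega)
      simpa using this

/-- A product as in `lenOff_prod_mul_zpow` is not conjugate into `⟨x_i⟩`, since the lengths of its
powers are unbounded. -/
theorem prod_mul_zpow_ne_conj {i : ι} {B : ℕ} {ps : List (FreeGroup ι × ℤ)} (h0 : ps ≠ [])
    (h : ∀ p ∈ ps, p.1 ∉ Subgroup.zpowers (of i) ∧ norm p.1 ≤ B ∧ 2 * B < p.2.natAbs)
    (c : FreeGroup ι) (e : ℤ) :
    (ps.map fun p => p.1 * of i ^ p.2).prod ≠ c * of i ^ e * c⁻¹ := by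
  intro heq
  set m := 2 * lenOff i c + 1 with hm
  have h1 := lenOff_prod_mul_zpow (i := i) (B := B) (ps := (List.replicate m ps).flatten) (by
    intro p hp
    obtain ⟨L, hL, hpL⟩ := List.mem_flatten.1 hp
    rw [List.eq_of_mem_replicate hL] at hpL
    exact h p hpL)
  rw [List.map_flatten, List.prod_flatten, List.map_replicate, List.map_replicate,
    List.prod_replicate, heq, conj_pow, ← zpow_natCast, ← zpow_mul, List.map_flatten,
    List.sum_flatten, List.map_replicate, List.map_replicate, List.sum_replicate] at h1
  have h2 := lenOff_conj_le i c (of i ^ (e * m))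
  rw [lenOff_of_zpow_self] at h2
  have h3 : 1 ≤ (ps.map fun p => lenOff i p.1).sum := by
    obtain ⟨p, hp⟩ := List.exists_mem_of_ne_nil ps h0
    have h4 := lenOff_pos (h p hp).1
    have h5 := List.single_le_sum (l := ps.map fun p => lenOff i p.1) (by simp) (lenOff i p.1)
      (List.mem_map_of_mem hp)
    omega
  rw [smul_eq_mul] at h1
  nlinarith

/-- An automorphism preserving the kernels of the retractions maps each generator to a conjugate of
a power of it. -/
theorem PreservesRetractKernels.exists_eq_conj_zpow {α : MulAut (FreeGroup ι)}
    (hα : PreservesRetractKernels α) (hι : ∀ i j : ι, ∃ l, l ≠ i ∧ l ≠ j) (i : ι) :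
    ∃ (c : FreeGroup ι) (e : ℤ), α (of i) = c * of i ^ e * c⁻¹ := by
  have hred : IsReduced (α (of i)).toWord := isReduced_toWord
  set V := reduceCyclically (α (of i)).toWord with hV
  set d : FreeGroup ι := mk (reduceCyclically.conjugator (α (of i)).toWord)
  have hconj : α (of i) = d * mk V * d⁻¹ := by
    rw [inv_mk, mul_mk, mul_mk, reduceCyclically.conj_conjugator_reduceCyclically, mk_toWord]
  have hVcyc : IsCyclicallyReduced V := reduceCyclically.isCyclicallyReduced hred
  suffices hVi : ∀ a ∈ V, a.1 = i by
    obtain ⟨e, -, he⟩ := exists_zpow_of_forall_fst_eq hVi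
    exact ⟨d, e, by rw [← he]; exact hconj⟩
  by_contra! hcon
  obtain ⟨⟨j, s⟩, ha, hji⟩ := hcon
  replace hji : j ≠ i := hji
  obtain ⟨l, hli, hlj⟩ := hι i j
  obtain ⟨V₁, V₂, hV12⟩ := List.append_of_mem ha
  -- `M` exceeds the length of every segment of `V`.
  set M := V.length + 1 with hM
  obtain ⟨K, hK⟩ := hα.exists_retract_eq_conj (Ne.symm hji) hlj M
  -- The segments between the powers of `x_i` have length at most `3 * M`, so these exponents exceed
  -- the bound in the big powers property.
  set k := K + 2 * (3 * M) + 1 with hk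
  obtain ⟨c, e, hce⟩ := hK k (by omega)
  -- The rotation of `V` that ends in the chosen letter.
  have hW : IsReduced ((j, s) :: ([] ++ (V₂ ++ V₁) ++ [(j, s)])) := by
    have h2 : IsReduced (V ++ V) := by
      simpa using (hVcyc.flatten_replicate 2).isReduced
    refine h2.infix ⟨V₁, V₂, ?_⟩
    rw [hV12]
    simp
  obtain ⟨ps, hps0, hps, hprod⟩ := exists_retract_mk_eq_prod (k := k) (M := M) hli.symm s s
    (V₂ ++ V₁) [] hW (by simp) (by
      have := congrArg List.length hV12
      simp at this ⊢
      omega)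
  set ψ := retract j (of l ^ (M : ℤ) * of i ^ (k : ℤ) * of l ^ (M : ℤ)) with hψ
  have hrot : (mk ([] ++ (V₂ ++ V₁) ++ [(j, s)]) : FreeGroup ι) =
      (mk V₁ * mk [(j, s)])⁻¹ * (d⁻¹ * α (of i) * d) * (mk V₁ * mk [(j, s)]) := by
    have e1 : (mk V : FreeGroup ι) = mk V₁ * mk [(j, s)] * mk V₂ := by
      rw [hV12]; simp [mul_mk]
    have e2 : (mk ([] ++ (V₂ ++ V₁) ++ [(j, s)]) : FreeGroup ι) = mk V₂ * mk V₁ * mk [(j, s)] := by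
      simp [mul_mk]
    rw [hconj, e2, e1]
    group
  replace hprod := eq_mul_inv_of_mul_eq hprod.symm
  refine prod_mul_zpow_ne_conj (i := i) hps0 (B := 3 * M) (fun p hp => ?_)
    (of l ^ (sgn s * M) * (ψ (mk V₁ * mk [(j, s)]))⁻¹ * (ψ d)⁻¹ * c) e ?_
  · obtain ⟨h1, h2, h3⟩ := hps p hp
    exact ⟨h1, h2, by omega⟩
  · rw [hprod, hrot]
    simp only [_root_.map_mul, _root_.map_inv, hce, mul_inv_rev, inv_inv, mul_assoc]

end FreeGroup

/-! ### Transvections and a criterion for being inner -/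

namespace FreeGroup

variable {ι : Type*} [DecidableEq ι]

theorem retract_eq_self_of_mem_others {j : ι} (u : FreeGroup ι) {v : FreeGroup ι}
    (hv : v ∈ others j) : retract j u v = v := by
  induction hv using Subgroup.closure_induction with
  | mem x hx =>
    obtain ⟨i, hi, rfl⟩ := hx
    exact retract_of_ne hi u
  | one => exact _root_.map_one _
  | mul x y _ _ hx hy => rw [_root_.map_mul, hx, hy]
  | inv x _ hx => rw [_root_.map_inv, hx]

/-- The Nielsen automorphism `x_j ↦ x_j u`, where `u` does not involve `x_j`. -/
def transvection (j : ι) (u : FreeGroup ι) (hu : u ∈ others j) : MulAut (FreeGroup ι) :=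
  MonoidHom.toMulEquiv (retract j (of j * u)) (retract j (of j * u⁻¹))
    (by
      ext i
      by_cases h : i = j
      · subst h
        simp [retract_eq_self_of_mem_others _ hu]
      · simp [retract_of_ne h])
    (by
      ext i
      by_cases h : i = j
      · subst h
        simp [retract_eq_self_of_mem_others _ hu]
      · simp [retract_of_ne h])

theorem transvection_self {j : ι} {u : FreeGroup ι} (hu : u ∈ others j) :
    transvection j u hu (of j) = of j * u := retract_self j _

theorem transvection_of_ne {i j : ι} (h : i ≠ j) {u : FreeGroup ι} (hu : u ∈ others j) :
    transvection j u hu (of i) = of i := retract_of_ne h _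

theorem transvection_inv {j : ι} {u : FreeGroup ι} (hu : u ∈ others j) :
    (transvection j u hu)⁻¹ = transvection j u⁻¹ (inv_mem hu) := by
  rw [inv_eq_iff_mul_eq_one]
  ext x : 1
  have : (transvection j u hu).toMonoidHom.comp (transvection j u⁻¹ (inv_mem hu)).toMonoidHom =
      MonoidHom.id _ := by
    ext i
    by_cases h : i = j
    · subst h
      change transvection i u hu (transvection i u⁻¹ (inv_mem hu) (of i)) = of i
      rw [transvection_self, _root_.map_mul, transvection_self]
      change of i * u * retract i _ u⁻¹ = _
      rw [retract_eq_self_of_mem_others _ (inv_mem hu), mul_inv_cancel_right]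
    · change transvection j u hu (transvection j u⁻¹ (inv_mem hu) (of i)) = of i
      rw [transvection_of_ne h, transvection_of_ne h]
  exact DFunLike.congr_fun this x

/-- An automorphism preserving the kernels of the retractions maps each generator to a conjugate of
the generator or of its inverse. -/
theorem PreservesRetractKernels.exists_eq_conj {α : MulAut (FreeGroup ι)}
    (hα : PreservesRetractKernels α) (hι : ∀ i j : ι, ∃ l, l ≠ i ∧ l ≠ j) (i : ι) :
    ∃ (c : FreeGroup ι) (e : ℤ), IsUnit e ∧ α (of i) = c * of i ^ e * c⁻¹ := by
  obtain ⟨c, e, h⟩ := hα.exists_eq_conj_zpow hι i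
  refine ⟨c, e, ?_, h⟩
  have h1 := congrArg (fun g => (expSum i (α⁻¹ g)).toAdd) h
  have h2 := toAdd_expSum_of_zpow i i 1
  rw [zpow_one, if_pos rfl] at h2
  simp only [MulAut.inv_apply_self, _root_.map_mul, map_zpow, _root_.map_inv, toAdd_mul, toAdd_zpow,
    toAdd_inv, h2, smul_eq_mul] at h1
  exact isUnit_of_dvd_one ⟨(expSum i (α⁻¹ (of i))).toAdd, by rw [h1]; ring⟩

section

variable {N : Subgroup (MulAut (FreeGroup ι))} [N.Normal]

/-- All automorphic images of a generator are mapped to conjugates of themselves or of their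
inverses by a normal subgroup of automorphisms preserving the kernels of the retractions. -/
theorem exists_eq_conj_of_mem_normal (hN : ∀ α ∈ N, PreservesRetractKernels α)
    (hι : ∀ i j : ι, ∃ l, l ≠ i ∧ l ≠ j) {α : MulAut (FreeGroup ι)} (hα : α ∈ N)
    (β : MulAut (FreeGroup ι)) (i : ι) :
    ∃ (c : FreeGroup ι) (e : ℤ), IsUnit e ∧ α (β (of i)) = c * β (of i) ^ e * c⁻¹ := by
  have h1 : β⁻¹ * α * β ∈ N := by
    simpa using ‹N.Normal›.conj_mem α hα β⁻¹
  obtain ⟨c, e, he, h⟩ := (hN _ h1).exists_eq_conj hι i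
  refine ⟨β c, e, he, ?_⟩
  have h2 := congrArg β h
  simpa [MulAut.mul_apply] using h2

theorem lenOff_zpow_le_of_isUnit (i : ι) (g : FreeGroup ι) {e : ℤ} (he : IsUnit e) :
    lenOff i (g ^ e) = lenOff i g := by
  rcases Int.isUnit_iff.1 he with rfl | rfl <;> simp

/-- If `x_i ↦ x_i ^ ±1`, then `x_j` is conjugated by a power of `x_i`, up to sign: otherwise the
image of the primitive element `x_j x_i ^ m`, for `m` large, is too long to be conjugate to it or
its inverse. -/
theorem exists_eq_zpow_conj_of_mem_normal (hN : ∀ α ∈ N, PreservesRetractKernels α)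
    (hι : ∀ i j : ι, ∃ l, l ≠ i ∧ l ≠ j) {α : MulAut (FreeGroup ι)} (hα : α ∈ N) {i j : ι}
    (hij : i ≠ j) {e : ℤ} (he : IsUnit e) (hi : α (of i) = of i ^ e) :
    ∃ a s : ℤ, IsUnit s ∧ α (of j) = of i ^ a * of j ^ s * of i ^ (-a) := by
  obtain ⟨c, s, hs, hj⟩ := (hN α hα).exists_eq_conj hι j
  set z := α (of j) with hz
  -- Exponent sums recover `x_j ^ s` from a word with a single letter other than `x_i`.
  have hexp : ∀ l, (expSum l z).toAdd = if j = l then s else 0 := by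
    intro l
    rw [hj]
    simp only [_root_.map_mul, _root_.map_inv, toAdd_mul, toAdd_inv, toAdd_expSum_of_zpow]
    ring
  have hs0 : s ≠ 0 := hs.ne_zero
  have hzi : z ∉ Subgroup.zpowers (of i) := by
    intro hmem
    obtain ⟨p, hp⟩ := Subgroup.mem_zpowers_iff.1 hmem
    have h1 := hexp j
    rw [← hp, toAdd_expSum_of_zpow, if_neg hij, if_pos rfl] at h1
    exact hs0 h1.symm
  have hle : lenOff i z ≤ 1 := by
    set m : ℕ := 2 * norm z + 1 with hm
    have hu : (of i ^ (m : ℤ) : FreeGroup ι) ∈ others j := zpow_mem (of_mem_others hij) _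
    obtain ⟨d, t, ht, hd⟩ := exists_eq_conj_of_mem_normal hN hι hα (transvection j _ hu) j
    rw [transvection_self, _root_.map_mul, map_zpow, hi, ← hz, ← zpow_mul] at hd
    set q := 2 * lenOff i d + 1 with hq
    have h1 := lenOff_prod_mul_zpow (i := i) (B := norm z) (ps := List.replicate q (z, e * m)) (by
      intro p hp
      rw [List.eq_of_mem_replicate hp]
      refine ⟨hzi, le_rfl, ?_⟩
      rw [Int.natAbs_mul, Int.isUnit_iff_natAbs_eq.1 he, Int.natAbs_natCast]
      omega)
    rw [List.map_replicate, List.map_replicate, List.prod_replicate, List.sum_replicate, hd,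
      conj_pow, smul_eq_mul] at h1
    dsimp only at h1
    have h2 := lenOff_conj_le i d (((of j * of i ^ (m : ℤ)) ^ t) ^ q)
    have h3 := lenOff_pow_le i ((of j * of i ^ (m : ℤ)) ^ t) q
    have h4 := lenOff_mul_le i (of j) (of i ^ (m : ℤ))
    have h5 := lenOff_of_zpow_le i j 1
    rw [lenOff_of_zpow_self] at h4
    rw [zpow_one, Int.natAbs_one] at h5
    rw [lenOff_zpow_le_of_isUnit i _ ht] at h3
    have h6 : q * lenOff i (of j * of i ^ (m : ℤ)) ≤ q * 1 := Nat.mul_le_mul_left q (by omega)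
    by_contra! hcon
    have h7 : q * 2 ≤ q * lenOff i z := Nat.mul_le_mul_left q hcon
    omega
  obtain ⟨p, q, L, -, -, hL0, -, hhead, hlast, hzL, hcount⟩ := exists_eq_zpow_mul_mk_mul_zpow hzi
  rw [hcount] at hle
  match L, hL0 with
  | [(l, b)], _ =>
    have hl : l ≠ i := hhead (l, b) (by simp)
    have e1 : (mk [(l, b)] : FreeGroup ι) = of l ^ sgn b := by
      cases b
      · rw [sgn, if_neg Bool.false_ne_true, zpow_neg_one]; rfl
      · rw [sgn, if_pos rfl, zpow_one]; rfl
    have hexp' : ∀ m, (expSum m z).toAdd =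
        (if i = m then p else 0) + (if l = m then sgn b else 0) + (if i = m then q else 0) := by
      intro m
      rw [hzL, e1]
      simp only [_root_.map_mul, toAdd_mul, toAdd_expSum_of_zpow]
    have h1 := hexp i
    have h2 := hexp j
    rw [hexp', if_pos rfl, if_neg hl, if_pos rfl, if_neg hij.symm] at h1
    rw [hexp', if_neg hij, if_neg hij, if_pos rfl] at h2
    have hlj : l = j := by
      by_contra hne
      rw [if_neg hne] at h2
      omega
    rw [if_pos hlj] at h2
    refine ⟨p, s, hs, ?_⟩
    rw [hzL, e1, hlj, show sgn b = s by omega, show q = -p by omega]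
  | a :: b :: L, _ =>
    exfalso
    have h1 : a.1 ≠ i := hhead a (by simp)
    have h2 : 1 ≤ (b :: L).countP (fun a => a.1 ≠ i) :=
      List.one_le_countP_iff.2 ⟨(b :: L).getLast (by simp), List.getLast_mem _, by
        simpa using hlast ((b :: L).getLast (by simp)) (by
          rw [List.getLast?_cons_cons, List.getLast?_eq_some_getLast (by simp)]
          rfl)⟩
    rw [List.countP_cons_of_pos (by simpa using h1)] at hle
    omega

/-- In a free group of rank at least `3`, a normal subgroup of automorphisms that preserve the
kernels of all retractions `x_j ↦ u ∈ ⟨x_i, i ≠ j⟩` consists of inner automorphisms. -/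
theorem le_Inn_of_preservesRetractKernels (hInn : Inn (FreeGroup ι) ≤ N)
    (hN : ∀ α ∈ N, PreservesRetractKernels α) {i₀ i₁ i₂ : ι} (h01 : i₀ ≠ i₁) (h02 : i₀ ≠ i₂)
    (h12 : i₁ ≠ i₂) : N ≤ Inn (FreeGroup ι) := by
  intro α hα
  have hι : ∀ i j : ι, ∃ l, l ≠ i ∧ l ≠ j := by
    intro i j
    by_contra! hcon
    have a0 := hcon i₀
    have a1 := hcon i₁
    have a2 := hcon i₂
    by_cases e0 : i₀ = i
    · exact h12 ((a1 (e0 ▸ h01.symm)).trans (a2 (e0 ▸ h02.symm)).symm)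
    · by_cases e1 : i₁ = i
      · exact h02 ((a0 e0).trans (a2 (e1 ▸ h12.symm)).symm)
      · exact h01 ((a0 e0).trans (a1 e1).symm)
  have hconj : ∀ c : FreeGroup ι, MulAut.conj c ∈ N := fun c => hInn ⟨c, rfl⟩
  obtain ⟨c, e₀, he₀, h0⟩ := (hN α hα).exists_eq_conj hι i₀
  set α₁ := MulAut.conj c⁻¹ * α with hα₁
  have hα₁N : α₁ ∈ N := mul_mem (hconj _) hα
  have h0' : α₁ (of i₀) = of i₀ ^ e₀ := by
    rw [hα₁, MulAut.mul_apply, h0, MulAut.conj_apply]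
    group
  obtain ⟨a, e₁, he₁, h1⟩ := exists_eq_zpow_conj_of_mem_normal hN hι hα₁N h01 he₀ h0'
  set α₂ := MulAut.conj (of i₀ ^ (-a)) * α₁ with hα₂
  have hα₂N : α₂ ∈ N := mul_mem (hconj _) hα₁N
  have h0'' : α₂ (of i₀) = of i₀ ^ e₀ := by
    rw [hα₂, MulAut.mul_apply, h0', MulAut.conj_apply]
    group
  have h1'' : α₂ (of i₁) = of i₁ ^ e₁ := by
    rw [hα₂, MulAut.mul_apply, h1, MulAut.conj_apply]
    group
  have hpow : ∀ j, ∃ e : ℤ, IsUnit e ∧ α₂ (of j) = of j ^ e := by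
    intro j
    by_cases hj0 : j = i₀
    · exact ⟨e₀, he₀, hj0 ▸ h0''⟩
    by_cases hj1 : j = i₁
    · exact ⟨e₁, he₁, hj1 ▸ h1''⟩
    obtain ⟨p, s, hs, hp⟩ :=
      exists_eq_zpow_conj_of_mem_normal hN hι hα₂N (Ne.symm hj0) he₀ h0''
    obtain ⟨q, t, ht, hq⟩ :=
      exists_eq_zpow_conj_of_mem_normal hN hι hα₂N (Ne.symm hj1) he₁ h1''
    -- Conjugating by a power of `x_{i₀}` and by a power of `x_{i₁}` agree only trivially.
    have h2 := congrArg (retract i₁ 1) (hp.symm.trans hq)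
    simp only [_root_.map_mul, map_zpow, retract_of_ne h01, retract_of_ne hj1, retract_self,
      one_zpow, one_mul, mul_one] at h2
    have h3 := lenOff_zpow_mul_zpow_mul_zpow hj0 hs.ne_zero p (-p)
    rw [h2, lenOff_of_zpow_self] at h3
    obtain rfl : p = 0 := by omega
    exact ⟨s, hs, by simpa using hp⟩
  choose ε hε hαε using hpow
  -- The retraction `x_j ↦ x_i⁻¹` kills `x_j x_i`.
  have hsign : ∀ i j, i ≠ j → ε i = ε j := by
    intro i j hij
    have hu : (of i : FreeGroup ι)⁻¹ ∈ others j := inv_mem (of_mem_others hij)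
    have h2 := hN α₂ hα₂N j _ hu (of j * of i) (by
      rw [_root_.map_mul, retract_self, retract_of_ne hij, inv_mul_cancel])
    rw [_root_.map_mul, _root_.map_mul, hαε, hαε, map_zpow, map_zpow, retract_self,
      retract_of_ne hij, inv_zpow', ← zpow_add] at h2
    have h3 := congrArg (fun g => (expSum i g).toAdd) h2
    simp only [toAdd_expSum_of_zpow, if_true, _root_.map_one, toAdd_one] at h3
    omega
  -- If all signs were `-1`, the retraction killing `x_{i₀} x_{i₁} x_{i₂}` would make `x_{i₀}` and
  -- `x_{i₁}` commute.
  have hone : ε i₀ = 1 := by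
    rcases Int.isUnit_iff.1 (hε i₀) with h | h
    · exact h
    exfalso
    have hm : ∀ j, α₂ (of j) = (of j)⁻¹ := by
      intro j
      have : ε j = -1 := by
        by_cases hj : i₀ = j
        · rw [← hj, h]
        · rw [← hsign i₀ j hj, h]
      rw [hαε, this, zpow_neg_one]
    have hu : (of i₀ * of i₁ : FreeGroup ι)⁻¹ ∈ others i₂ :=
      inv_mem (mul_mem (of_mem_others h02) (of_mem_others h12))
    have h2 := hN α₂ hα₂N i₂ _ hu (of i₀ * of i₁ * of i₂) (by
      simp only [_root_.map_mul, retract_self, retract_of_ne h02, retract_of_ne h12,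
        mul_inv_cancel])
    simp only [_root_.map_mul, hm, _root_.map_inv, retract_self, retract_of_ne h02,
      retract_of_ne h12, inv_inv] at h2
    have h3 : (of i₁ ^ (-1 : ℤ) * of i₀ ^ (1 : ℤ) * of i₁ ^ (1 : ℤ) : FreeGroup ι) =
        of i₀ ^ (1 : ℤ) := by
      simp only [zpow_neg_one, zpow_one]
      rw [mul_assoc, inv_mul_eq_one] at h2
      rw [mul_assoc, ← h2]
    have h4 := lenOff_zpow_mul_zpow_mul_zpow h01 one_ne_zero (-1) 1
    rw [h3, lenOff_of_zpow_self] at h4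
    simp at h4
  have hα₂1 : α₂ = 1 := by
    have : α₂.toMonoidHom = MonoidHom.id _ := by
      ext j
      change α₂ (of j) = of j
      have : ε j = 1 := by
        by_cases hj : i₀ = j
        · rw [← hj, hone]
        · rw [← hsign i₀ j hj, hone]
      rw [hαε, this, zpow_one]
    ext x : 1
    exact DFunLike.congr_fun this x
  have h5 : α = (MulAut.conj c⁻¹)⁻¹ * (MulAut.conj (of i₀ ^ (-a)))⁻¹ := by
    rw [← mul_inv_rev]
    exact eq_inv_of_mul_eq_one_right (by rw [mul_assoc]; exact hα₂1)
  rw [h5]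
  exact mul_mem (inv_mem ⟨_, rfl⟩) (inv_mem ⟨_, rfl⟩)

end

end FreeGroup

/-! ### Laws and faithfulness -/

namespace FreeGroup

/-- A free group of finite rank embeds into any free group with two distinct generators `x_i`, `x_j`
by `x_k ↦ x_i ^ k x_j x_i ^ -k`; the target maps to the semidirect product of the free group on `ℤ`
with the shift, where these elements become the free generators. -/
theorem injective_lift_zpow_conj {ι : Type*} {i j : ι} (hij : i ≠ j) (m : ℕ) :
    Function.Injective
      (lift fun k : Fin m => (of i ^ (k : ℤ) * of j * of i ^ (-(k : ℤ)) : FreeGroup ι)) := by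
  classical
  let τ : MulAut (FreeGroup ℤ) := freeGroupCongr (Equiv.addRight (1 : ℤ))
  let φ : Multiplicative ℤ →* MulAut (FreeGroup ℤ) := zpowersHom _ τ
  let Φ : FreeGroup ι →* FreeGroup ℤ ⋊[φ] Multiplicative ℤ := lift fun l =>
    if l = i then SemidirectProduct.inr (Multiplicative.ofAdd 1)
    else if l = j then SemidirectProduct.inl (of 0) else 1
  have hτ : ∀ (k : ℕ) (a : ℤ), (τ ^ k) (of a) = of (a + k) := by
    intro k
    induction k with
    | zero => intro a; simp
    | succ k ih =>
      intro a
      rw [pow_succ, MulAut.mul_apply]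
      have : τ (of a) = of (a + 1) := by simp [τ]
      rw [this, ih]
      congr 1
      push_cast
      ring
  have hcomp : Φ.comp (lift fun k : Fin m => (of i ^ (k : ℤ) * of j * of i ^ (-(k : ℤ)))) =
      SemidirectProduct.inl.comp (map fun k : Fin m => ((k : ℕ) : ℤ)) := by
    ext k : 1
    have h1 : Φ (of i) = SemidirectProduct.inr (Multiplicative.ofAdd 1) := by simp [Φ]
    have h2 : Φ (of j) = SemidirectProduct.inl (of 0) := by simp [Φ, hij.symm]
    simp only [MonoidHom.comp_apply, lift_apply_of, map.of, _root_.map_mul, map_zpow, h1, h2]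
    have h3 : φ (Multiplicative.ofAdd 1 ^ (k : ℤ)) (of 0) = of ((k : ℕ) : ℤ) := by
      rw [map_zpow, show φ (Multiplicative.ofAdd 1) = τ by simp [φ], zpow_natCast, hτ, zero_add]
    rw [← h3, SemidirectProduct.inl_aut, zpow_neg, map_zpow, _root_.map_inv, map_zpow]
  have hinj : Function.Injective
      (SemidirectProduct.inl.comp (map fun k : Fin m => ((k : ℕ) : ℤ)) :
        FreeGroup (Fin m) →* FreeGroup ℤ ⋊[φ] Multiplicative ℤ) := by
    rw [MonoidHom.coe_comp]
    refine SemidirectProduct.inl_injective.comp (map_injective ?_)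
    intro a b h
    simpa [Fin.ext_iff] using h
  rw [← hcomp, MonoidHom.coe_comp] at hinj
  exact hinj.of_comp

theorem lift_mem_of_mem_others {ι G : Type*} [Group G] {j : ι} {w : FreeGroup ι}
    (hw : w ∈ others j) (g : ι → G) : lift g w ∈ Subgroup.closure (g '' {j}ᶜ) := by
  have h1 := Subgroup.mem_map_of_mem (lift g) hw
  rw [others, MonoidHom.map_closure, Set.image_image] at h1
  simpa using h1

end FreeGroup

theorem IsTarskiMonster.eq_top_of_not_commute {G : Type*} [Group G] (hG : IsTarskiMonster G)
    {H : Subgroup G} {a b : G} (ha : a ∈ H) (hb : b ∈ H) (hab : ¬ Commute a b) : H = ⊤ := by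
  by_contra hH
  have := hG.2 H hH
  have h1 := (IsCyclic.isMulCommutative (α := H)).is_comm.comm ⟨a, ha⟩ ⟨b, hb⟩
  exact hab (congrArg Subtype.val h1)

open FreeGroup

section

variable {G : Type*} [Group G] {n : ℕ}

/-- A group law of `G` may be written in any set of at least two letters. -/
theorem SatisfiesGroupLaw.exists_mem_others (h : SatisfiesGroupLaw G) {i j l : Fin n} (hij : i ≠ j)
    (hil : i ≠ l) (hjl : j ≠ l) :
    ∃ w ∈ others l, w ≠ 1 ∧ ∀ g : Fin n → G, lift g w = 1 := by
  obtain ⟨m, w, hw, hlaw⟩ := h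
  set f : Fin m → FreeGroup (Fin n) := fun k => of i ^ (k : ℤ) * of j * of i ^ (-(k : ℤ)) with hf
  refine ⟨lift f w, ?_, ?_, fun g => ?_⟩
  · have h1 : (lift f).range ≤ others l := by
      rw [range_lift_eq_closure, Subgroup.closure_le]
      rintro _ ⟨k, rfl⟩
      exact mul_mem (mul_mem (zpow_mem (of_mem_others hil) _) (of_mem_others hjl))
        (zpow_mem (of_mem_others hil) _)
    exact h1 ⟨w, rfl⟩
  · intro h1
    exact hw (injective_lift_zpow_conj hij m (h1.trans (_root_.map_one _).symm))
  · have h1 : (lift g).comp (lift f) = lift fun k => lift g (f k) := by ext k; simp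
    rw [← MonoidHom.comp_apply, h1]
    exact hlaw _

/-- If `G` satisfies a law, then a transvection along that law acts trivially. -/
theorem SatisfiesGroupLaw.not_faithfulSMul (h : SatisfiesGroupLaw G) {i j l : Fin n} (hij : i ≠ j)
    (hil : i ≠ l) (hjl : j ≠ l) :
    ¬ FaithfulSMul (Out (FreeGroup (Fin n))) (GenTupleClass n G) := by
  intro hfaith
  obtain ⟨w, hwl, hw1, hw⟩ := h.exists_mem_others hij hil hjl
  set α := transvection l w hwl with hα
  have hact : ∀ g : GenTuple n G, GenTuple.act α g = g := by
    intro g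
    apply Subtype.ext
    funext k
    change lift g.1 (α⁻¹ (of k)) = g.1 k
    rw [hα, transvection_inv]
    by_cases hk : k = l
    · subst hk
      rw [transvection_self, _root_.map_mul, _root_.map_inv, hw]
      simp
    · rw [transvection_of_ne hk]
      simp
  have h1 : (QuotientGroup.mk α : Out (FreeGroup (Fin n))) = 1 := by
    apply hfaith.eq_of_smul_eq_smul
    intro x
    induction x using Quotient.inductionOn with
    | _ g =>
      exact (GenTupleClass.smul_mk α g).trans
        ((congrArg GenTupleClass.mk (hact g)).trans (one_smul _ (GenTupleClass.mk g)).symm)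
  obtain ⟨x, hx⟩ := (QuotientGroup.eq_one_iff α).1 h1
  have h2 : retract l 1 (α (of l)) = w := by
    rw [hα, transvection_self, _root_.map_mul, retract_self, one_mul,
      retract_eq_self_of_mem_others _ hwl]
  rw [← hx, MulAut.conj_apply, _root_.map_mul, _root_.map_mul, _root_.map_inv, retract_self,
    mul_one, mul_inv_cancel] at h2
  exact hw1 h2.symm

/-- If a Tarski monster satisfies no law, then a nontrivial word not involving `x_j` is nontrivial
on some tuple that generates without its `j`-th entry: apply the absence of laws to a nontrivial
commutator of the word, which vanishes on tuples with commuting entries. -/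
theorem IsTarskiMonster.exists_lift_ne_one (hG : IsTarskiMonster G) (hlaw : ¬ SatisfiesGroupLaw G)
    {i i' j : Fin n} (hi : i ≠ j) (hi' : i' ≠ j) (hii' : i ≠ i') {w : FreeGroup (Fin n)}
    (hwj : w ∈ others j) (hw : w ≠ 1) :
    ∃ g : Fin n → G, Subgroup.closure (g '' {j}ᶜ) = ⊤ ∧ lift g w ≠ 1 := by
  obtain ⟨l, hl, hwl⟩ : ∃ l ≠ j, w ∉ Subgroup.zpowers (of l) := by
    by_contra! hcon
    obtain ⟨p, hp⟩ := Subgroup.mem_zpowers_iff.1 (hcon i hi)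
    obtain ⟨q, hq⟩ := Subgroup.mem_zpowers_iff.1 (hcon i' hi')
    have h1 := congrArg (fun g => (expSum i g).toAdd) (hp.trans hq.symm)
    simp only [toAdd_expSum_of_zpow, if_true, if_neg hii'.symm] at h1
    rw [h1, zpow_zero] at hp
    exact hw hp.symm
  set m : ℕ := 2 * norm w + 1 with hm
  set c : FreeGroup (Fin n) := w * of l ^ (m : ℤ) * (w⁻¹ * of l ^ (-m : ℤ)) with hc
  have hc1 : c ≠ 1 := by
    intro h1
    have h2 := lenOff_prod_mul_zpow (i := l) (B := norm w) (ps := [(w, (m : ℤ)), (w⁻¹, (-m : ℤ))])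
      (by
        intro p hp
        simp only [List.mem_cons, List.not_mem_nil, or_false] at hp
        rcases hp with rfl | rfl
        · exact ⟨hwl, le_rfl, by simp; omega⟩
        · exact ⟨by simpa using hwl, by simp, by simp; omega⟩)
    simp only [List.map_cons, List.map_nil, List.prod_cons, List.prod_nil, List.sum_cons,
      List.sum_nil, mul_one, lenOff_inv] at h2
    rw [← hc, h1, lenOff_one] at h2
    have := lenOff_pos hwl
    omega
  obtain ⟨g, hg⟩ : ∃ g : Fin n → G, lift g c ≠ 1 := by
    by_contra! hcon
    exact hlaw ⟨n, c, hc1, hcon⟩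
  have hncomm : ¬ Commute (lift g w) (lift g (of l ^ (m : ℤ))) := by
    intro hcomm
    apply hg
    rw [hc, zpow_neg, _root_.map_mul, _root_.map_mul, _root_.map_mul, hcomm.eq, _root_.map_inv,
      _root_.map_inv]
    group
  refine ⟨g, hG.eq_top_of_not_commute (lift_mem_of_mem_others hwj g)
    (lift_mem_of_mem_others (zpow_mem (of_mem_others hl) _) g) hncomm, fun h1 => ?_⟩
  rw [h1] at hncomm
  exact hncomm (Commute.one_left _)

/-- Without a law, the epimorphisms `F_n → G` that factor through a retraction have no common kernel
beyond that of the retraction, so an automorphism that acts trivially preserves this kernel. -/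
theorem IsTarskiMonster.preservesRetractKernels (hG : IsTarskiMonster G)
    (hlaw : ¬ SatisfiesGroupLaw G) (hn : ∀ j : Fin n, ∃ i i' : Fin n, i ≠ j ∧ i' ≠ j ∧ i ≠ i')
    {α : MulAut (FreeGroup (Fin n))} (hα : ∀ g : GenTuple n G, GenTuple.act α g ≈ g) :
    PreservesRetractKernels α := by
  intro j u hu v hv
  by_contra hne
  have hmem : retract j u (α v) ∈ others j := by
    have h1 : (retract j u).range ≤ others j := by
      rw [retract, range_lift_eq_closure, Subgroup.closure_le]
      rintro _ ⟨k, rfl⟩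
      by_cases hk : k = j
      · subst hk; simpa using hu
      · rw [Function.update_of_ne hk]; exact of_mem_others hk
    exact h1 ⟨_, rfl⟩
  obtain ⟨i, i', hi, hi', hii'⟩ := hn j
  obtain ⟨g, hg, hgv⟩ := hG.exists_lift_ne_one hlaw hi hi' hii' hmem hne
  have hcomp : lift (fun k => lift g (retract j u (of k))) = (lift g).comp (retract j u) := by
    ext k; simp
  set g' : Fin n → G := fun k => lift g (retract j u (of k)) with hg'
  have hgen : Subgroup.closure (Set.range g') = ⊤ := by
    rw [eq_top_iff, ← hg]
    apply Subgroup.closure_mono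
    rintro _ ⟨k, hk, rfl⟩
    exact ⟨k, by rw [hg']; simp [retract_of_ne hk]⟩
  obtain ⟨γ, hγ⟩ : ∃ γ : GenTuple n G, γ.1 = g' := ⟨⟨g', hgen⟩, rfl⟩
  obtain ⟨σ, hσ⟩ := hα γ
  have h1 : σ.toMonoidHom.comp (lift (GenTuple.act α γ).1) = lift g' := by
    ext k
    simpa [hγ] using hσ k
  have h2 := DFunLike.congr_fun h1 (α v)
  rw [MonoidHom.comp_apply, GenTuple.lift_act, MulAut.inv_apply_self, hγ, hcomp,
    MonoidHom.comp_apply, MonoidHom.comp_apply, hv] at h2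
  apply hgv
  rw [← h2]
  simp

theorem IsTarskiMonster.faithfulSMul (hG : IsTarskiMonster G) (hlaw : ¬ SatisfiesGroupLaw G)
    (hn : 3 ≤ n) : FaithfulSMul (Out (FreeGroup (Fin n))) (GenTupleClass n G) := by
  have hn' : ∀ j : Fin n, ∃ i i' : Fin n, i ≠ j ∧ i' ≠ j ∧ i ≠ i' := by
    intro j
    have h1 : 1 < ((Finset.univ : Finset (Fin n)).erase j).card := by
      rw [Finset.card_erase_of_mem (Finset.mem_univ j), Finset.card_univ, Fintype.card_fin]
      omega
    obtain ⟨a, ha, b, hb, hab⟩ := Finset.one_lt_card.1 h1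
    exact ⟨a, b, Finset.ne_of_mem_erase ha, Finset.ne_of_mem_erase hb, hab⟩
  set N : Subgroup (MulAut (FreeGroup (Fin n))) :=
    (MulAction.toPermHom (Out (FreeGroup (Fin n))) (GenTupleClass n G)).ker.comap
      (QuotientGroup.mk' (Inn (FreeGroup (Fin n)))) with hN
  have hmem : ∀ α, α ∈ N ↔ ∀ x : GenTupleClass n G,
      (QuotientGroup.mk α : Out (FreeGroup (Fin n))) • x = x := by
    intro α
    rw [hN, Subgroup.mem_comap, MonoidHom.mem_ker, Equiv.ext_iff]
    rfl
  have hle : N ≤ Inn (FreeGroup (Fin n)) := by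
    refine le_Inn_of_preservesRetractKernels (i₀ := ⟨0, by omega⟩) (i₁ := ⟨1, by omega⟩)
      (i₂ := ⟨2, by omega⟩) ?_ ?_ (by simp) (by simp) (by simp)
    · intro α hα
      rw [hmem, (QuotientGroup.eq_one_iff α).2 hα]
      exact one_smul _
    · intro α hα
      refine hG.preservesRetractKernels hlaw hn' fun g => ?_
      exact Quotient.exact ((hmem α).1 hα (GenTupleClass.mk g))
  refine ⟨fun {γ δ} h => ?_⟩
  rw [← inv_mul_eq_one]
  obtain ⟨α, hα⟩ := QuotientGroup.mk_surjective (γ⁻¹ * δ)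
  rw [← hα, QuotientGroup.eq_one_iff]
  apply hle
  rw [hmem, hα]
  intro x
  rw [mul_smul, ← h x, inv_smul_smul]

end

/-! ### Group theory of simple Tarski monsters -/

namespace IsTarskiMonster

variable {G : Type*} [Group G]

theorem exists_not_commute [IsSimpleGroup G] (hG : IsTarskiMonster G) :
    ∃ a b : G, ¬ Commute a b := by
  by_contra! hcon
  obtain ⟨g, hg⟩ := exists_ne (1 : G)
  have hn : (Subgroup.zpowers g).Normal := ⟨fun x hx y => by
    rwa [(hcon y x).eq, mul_inv_cancel_right]⟩
  rcases hn.eq_bot_or_eq_top with h | h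
  · exact hg (Subgroup.zpowers_eq_bot.1 h)
  · exact hG.1 (isCyclic_iff_exists_zpowers_eq_top.2 ⟨g, h⟩)

theorem center_eq_bot [IsSimpleGroup G] (hG : IsTarskiMonster G) : Subgroup.center G = ⊥ := by
  obtain ⟨a, b, hab⟩ := hG.exists_not_commute
  refine (Subgroup.Normal.eq_bot_or_eq_top inferInstance).resolve_right fun h => hab ?_
  have ha : a ∈ Subgroup.center G := h ▸ Subgroup.mem_top a
  exact (Subgroup.mem_center_iff.1 ha b).symm

theorem centralizer_ne_top [IsSimpleGroup G] (hG : IsTarskiMonster G) {x : G} (hx : x ≠ 1) :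
    Subgroup.centralizer {x} ≠ ⊤ := by
  intro h
  apply hx
  rw [← Subgroup.mem_bot, ← hG.center_eq_bot, Subgroup.mem_center_iff]
  intro y
  have hy : y ∈ Subgroup.centralizer {x} := h ▸ Subgroup.mem_top y
  exact Subgroup.mem_centralizer_singleton_iff.1 hy

theorem commutator_eq_top [IsSimpleGroup G] (hG : IsTarskiMonster G) :
    ⁅(⊤ : Subgroup G), (⊤ : Subgroup G)⁆ = ⊤ := by
  obtain ⟨a, b, hab⟩ := hG.exists_not_commute
  refine (Subgroup.Normal.eq_bot_or_eq_top (H := ⁅(⊤ : Subgroup G), (⊤ : Subgroup G)⁆)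
    inferInstance).resolve_left fun h => hab ?_
  have h1 := Subgroup.commutator_mem_commutator (Subgroup.mem_top a) (Subgroup.mem_top b)
  rw [h, Subgroup.mem_bot, commutatorElement_eq_one_iff_mul_comm] at h1
  exact h1

/-- A finite group whose Sylow subgroups are cyclic is solvable, so a finite simple group whose
proper subgroups are cyclic is cyclic. -/
theorem infinite [IsSimpleGroup G] (hG : IsTarskiMonster G) : Infinite G := by
  by_contra hfin
  rw [not_infinite_iff_finite] at hfin
  have hsolv : ¬ Group.IsSolvable G := by
    intro hs
    obtain ⟨a, b, hab⟩ := hG.exists_not_commute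
    exact hab (IsSimpleGroup.comm_iff_isSolvable.2 hs a b)
  by_cases hS : ∃ (p : ℕ) (_ : Fact p.Prime) (P : Sylow p G), (P : Subgroup G) = ⊤
  · obtain ⟨p, hp, P, hP⟩ := hS
    have h1 : IsPGroup p G := by
      have := P.isPGroup'
      rw [hP] at this
      exact this.of_equiv Subgroup.topEquiv
    have := h1.isNilpotent
    exact hsolv inferInstance
  · have : IsZGroup G := ⟨fun p hp P => hG.2 _ fun h => hS ⟨p, ⟨hp⟩, P, h⟩⟩
    exact hsolv inferInstance

theorem not_finiteIndex [IsSimpleGroup G] (hG : IsTarskiMonster G) {H : Subgroup G} (hH : H ≠ ⊤) :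
    ¬ H.FiniteIndex := by
  intro hfin
  have := hG.infinite
  rcases (Subgroup.normalCore_normal H).eq_bot_or_eq_top with h | h
  · have h1 : H.normalCore.FiniteIndex := inferInstance
    rw [h] at h1
    have := Subgroup.finite_quotient_of_finiteIndex (H := (⊥ : Subgroup G))
    exact not_finite_iff_infinite.2 ‹Infinite G›
      (Finite.of_equiv _ (QuotientGroup.quotientBot (G := G)).toEquiv)
  · exact hH (top_le_iff.1 (h ▸ H.normalCore_le))

/-- By B. H. Neumann's lemma, two proper subgroups and a finite set do not cover the group. -/
theorem exists_notMem [IsSimpleGroup G] (hG : IsTarskiMonster G) {H K : Subgroup G} (hH : H ≠ ⊤)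
    (hK : K ≠ ⊤) {S : Set G} (hS : S.Finite) : ∃ z, z ∉ H ∧ z ∉ K ∧ z ∉ S := by
  classical
  by_contra! hcon
  have hbot : (⊥ : Subgroup G) ≠ ⊤ := bot_ne_top
  obtain ⟨k, -, hk⟩ := Subgroup.exists_finiteIndex_of_leftCoset_cover
    (H := Sum.elim (fun t : Bool => if t then H else K) fun _ : G => ⊥)
    (g := Sum.elim (fun _ => 1) id) (s := Finset.univ.disjSum hS.toFinset) (by
      rw [Set.eq_univ_iff_forall]
      intro z
      rw [Set.mem_iUnion₂]
      by_cases hzH : z ∈ H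
      · exact ⟨Sum.inl true, by simp, by simpa using hzH⟩
      by_cases hzK : z ∈ K
      · exact ⟨Sum.inl false, by simp, by simpa using hzK⟩
      · exact ⟨Sum.inr z, by simpa using hcon z hzH hzK, by simp⟩)
  rcases k with (_ | _) | _
  · exact hG.not_finiteIndex hK hk
  · exact hG.not_finiteIndex hH hk
  · exact hG.not_finiteIndex hbot hk

theorem exists_not_commute_and_notMem [IsSimpleGroup G] (hG : IsTarskiMonster G) {x y : G}
    (hx : x ≠ 1) (hy : y ≠ 1) {S : Set G} (hS : S.Finite) :
    ∃ z, ¬ Commute x z ∧ ¬ Commute y z ∧ z ∉ S := by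
  obtain ⟨z, h1, h2, h3⟩ := hG.exists_notMem (hG.centralizer_ne_top hx)
    (hG.centralizer_ne_top hy) hS
  exact ⟨z, fun h => h1 (Subgroup.mem_centralizer_singleton_iff.2 h.eq.symm),
    fun h => h2 (Subgroup.mem_centralizer_singleton_iff.2 h.eq.symm), h3⟩

/-- Nontrivial conjugacy classes are infinite. -/
theorem exists_conj_notMem [IsSimpleGroup G] (hG : IsTarskiMonster G) {s : G} (hs : s ≠ 1)
    (T : Finset G) : ∃ h : G, h * s * h⁻¹ ∉ T := by
  by_contra! hcon
  have h1 : ∀ t : G, ∃ g : G, (∃ h, h * s * h⁻¹ = t) → g * s * g⁻¹ = t := by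
    intro t
    by_cases ht : ∃ h, h * s * h⁻¹ = t
    · exact ⟨ht.choose, fun _ => ht.choose_spec⟩
    · exact ⟨1, fun h => absurd h ht⟩
  choose g hg using h1
  refine hG.not_finiteIndex (hG.centralizer_ne_top hs)
    (Subgroup.finiteIndex_of_leftCoset_cover_const (s := T) (g := g) ?_)
  rw [Set.eq_univ_iff_forall]
  intro h
  rw [Set.mem_iUnion₂]
  refine ⟨h * s * h⁻¹, hcon h, ?_⟩
  rw [Set.mem_smul_set_iff_inv_smul_mem, smul_eq_mul, SetLike.mem_coe,
    Subgroup.mem_centralizer_singleton_iff]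
  have h2 := hg (h * s * h⁻¹) ⟨h, rfl⟩
  set k := g (h * s * h⁻¹)
  have h3 : s = k⁻¹ * (h * s * h⁻¹) * k := by rw [← h2]; group
  calc k⁻¹ * h * s = k⁻¹ * (h * s * h⁻¹) * k * (k⁻¹ * h) := by group
    _ = s * (k⁻¹ * h) := by rw [← h3]

/-- Automorphisms are determined by their values on two elements that do not commute. -/
theorem mulAut_eq (hG : IsTarskiMonster G) {x y : G} (hxy : ¬ Commute x y) {σ τ : MulAut G}
    (hx : σ x = τ x) (hy : σ y = τ y) : σ = τ := by
  have h1 : σ.toMonoidHom.eqLocus τ.toMonoidHom = ⊤ := hG.eq_top_of_not_commute hx hy hxy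
  ext z
  have hz : z ∈ σ.toMonoidHom.eqLocus τ.toMonoidHom := h1 ▸ Subgroup.mem_top z
  exact hz

theorem finite_setOf_exists_mulAut (hG : IsTarskiMonster G) {x y : G} (hxy : ¬ Commute x y)
    (x' y' z' : G) : {z | ∃ σ : MulAut G, σ x = x' ∧ σ y = y' ∧ σ z = z'}.Finite := by
  apply Set.Subsingleton.finite
  rintro z ⟨σ, hx, hy, hz⟩ w ⟨τ, hx', hy', hw⟩
  obtain rfl := hG.mulAut_eq hxy (hx.trans hx'.symm) (hy.trans hy'.symm)
  exact σ.injective (hz.trans hw.symm)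

/-- The commutator argument behind Hall's lemma on subdirect products of nonabelian simple
groups. -/
theorem map_iInf_ker_eq_top [IsSimpleGroup G] (hG : IsTarskiMonster G) {F κ : Type*} [Group F]
    {ψ : F →* G} (hψ : Function.Surjective ψ) (φ : κ → F →* G) (S : Finset κ)
    (h : ∀ c ∈ S, ¬ (φ c).ker ≤ ψ.ker) : (⨅ c ∈ S, (φ c).ker).map ψ = ⊤ := by
  classical
  induction S using Finset.induction_on with
  | empty => simpa using Subgroup.map_top_of_surjective ψ hψ
  | insert c S _ ih =>
    have h1 := ih fun d hd => h d (Finset.mem_insert_of_mem hd)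
    have h2 : (φ c).ker.map ψ = ⊤ := by
      have hn : ((φ c).ker.map ψ).Normal := Subgroup.Normal.map inferInstance ψ hψ
      refine hn.eq_bot_or_eq_top.resolve_left fun hb => h c (Finset.mem_insert_self c S) ?_
      rwa [Subgroup.map_eq_bot_iff] at hb
    rw [Finset.iInf_insert, eq_top_iff, ← hG.commutator_eq_top]
    nth_rw 1 [← h2]
    rw [← h1, ← Subgroup.map_commutator]
    have : (⨅ d ∈ S, (φ d).ker).Normal :=
      Subgroup.normal_iInf_normal fun d => Subgroup.normal_iInf_normal fun _ => inferInstance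
    exact Subgroup.map_mono (Subgroup.commutator_le_inf _ _)

/-- Two epimorphisms onto a simple group with comparable kernels differ by an automorphism. -/
theorem _root_.exists_mulAut_of_ker_le [IsSimpleGroup G] {F : Type*} [Group F] {φ ψ : F →* G}
    (hφ : Function.Surjective φ) (hψ : Function.Surjective ψ) (h : φ.ker ≤ ψ.ker) :
    ∃ σ : MulAut G, ∀ x, σ (ψ x) = φ x := by
  let τ : G →* G := φ.liftOfSurjective hφ ⟨ψ, h⟩
  have hτ : ∀ x, τ (φ x) = ψ x := fun x => φ.liftOfRightInverse_comp_apply _ _ ⟨ψ, h⟩ x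
  have hsurj : Function.Surjective τ := fun y => by
    obtain ⟨x, rfl⟩ := hψ y
    exact ⟨φ x, hτ x⟩
  have hinj : Function.Injective τ := by
    rw [← MonoidHom.ker_eq_bot_iff]
    refine (Subgroup.Normal.eq_bot_or_eq_top inferInstance).resolve_right fun ht => ?_
    obtain ⟨g, hg⟩ := exists_ne (1 : G)
    obtain ⟨x, rfl⟩ := hsurj g
    exact hg (MonoidHom.mem_ker.1 (ht ▸ Subgroup.mem_top x))
  let e : MulAut G := MulEquiv.ofBijective τ ⟨hinj, hsurj⟩
  refine ⟨e⁻¹, fun x => ?_⟩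
  rw [← hτ x]
  exact MulAut.inv_apply_self G e (φ x)

end IsTarskiMonster

/-! ### Moving a tuple while fixing the standard tuples -/

section

variable {G : Type*} [Group G] {n : ℕ}

theorem lift_surjective_iff {ι : Type*} {y : ι → G} :
    Function.Surjective (lift y) ↔ Subgroup.closure (Set.range y) = ⊤ := by
  rw [← MonoidHom.range_eq_top, range_lift_eq_closure]

theorem lift_mulAut_comp {ι : Type*} (σ : MulAut G) (y : ι → G) (v : FreeGroup ι) :
    lift (σ ∘ y) v = σ (lift y v) := by
  have h : lift (σ ∘ y) = σ.toMonoidHom.comp (lift y) := by ext i; simp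
  rw [h]; rfl

theorem lift_eq_of_eqOn {ι : Type*} {A : Set ι} {y y' : ι → G} (h : Set.EqOn y y' A)
    {v : FreeGroup ι} (hv : v ∈ Subgroup.closure (of '' A)) : lift y v = lift y' v := by
  have h1 : Set.EqOn (lift y) (lift y') (of '' A) := by
    rintro _ ⟨i, hi, rfl⟩
    simpa using h hi
  exact MonoidHom.eqOn_closure h1 hv

theorem lift_aut_eq {ι : Type*} {α : MulAut (FreeGroup ι)} {y y' : ι → G}
    (h : ∀ i, lift y (α (of i)) = y' i) (v : FreeGroup ι) : lift y (α v) = lift y' v := by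
  have h1 : (lift y).comp α.toMonoidHom = lift y' := by
    ext i
    simpa using h i
  exact DFunLike.congr_fun h1 v

/-- The tuple `(a, b, c, 1, …, 1)`. -/
def stdTuple (n : ℕ) (a b c : G) : Fin n → G := fun i =>
  if i.1 = 0 then a else if i.1 = 1 then b else if i.1 = 2 then c else 1

theorem stdTuple_of_three_le (a b c : G) {i : Fin n} (h : 3 ≤ i.1) : stdTuple n a b c i = 1 := by
  rw [stdTuple, if_neg (by omega), if_neg (by omega), if_neg (by omega)]

/-- Some automorphism of `F_n` carries the tuple `y` to `y'` and fixes `(a, b, c, 1, …, 1)` for all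
`c ∈ S`. -/
def Reach (a b : G) (S : Finset G) (y y' : Fin n → G) : Prop :=
  ∃ α : MulAut (FreeGroup (Fin n)),
    (∀ c ∈ S, ∀ i, lift (stdTuple n a b c) (α (of i)) = stdTuple n a b c i) ∧
      ∀ i, lift y (α (of i)) = y' i

namespace Reach

variable {a b : G} {S : Finset G} {y y' y'' : Fin n → G}

theorem refl (y : Fin n → G) : Reach a b S y y :=
  ⟨1, fun c _ i => by simp, fun i => by simp⟩

theorem trans (h : Reach a b S y y') (h' : Reach a b S y' y'') : Reach a b S y y'' := by
  obtain ⟨α, hα, hy⟩ := h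
  obtain ⟨β, hβ, hy'⟩ := h'
  refine ⟨α * β, fun c hc i => ?_, fun i => ?_⟩
  · rw [MulAut.mul_apply, lift_aut_eq (hα c hc), hβ c hc]
  · rw [MulAut.mul_apply, lift_aut_eq hy, hy']

theorem surjective (h : Reach a b S y y') (hy : Function.Surjective (lift y)) :
    Function.Surjective (lift y') := by
  obtain ⟨α, -, hα⟩ := h
  have h1 : ⇑(lift y') = lift y ∘ α := funext fun v => (lift_aut_eq hα v).symm
  rw [h1]
  exact hy.comp α.surjective

theorem inequivalent (h : Reach a b S y y')
    (hy : ∀ c ∈ S, ∀ σ : MulAut G, σ ∘ y ≠ stdTuple n a b c) :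
    ∀ c ∈ S, ∀ σ : MulAut G, σ ∘ y' ≠ stdTuple n a b c := by
  obtain ⟨α, hα, hy'⟩ := h
  intro c hc σ hσ
  refine hy c hc σ (funext fun i => ?_)
  have h1 : lift (σ ∘ y) (α (α⁻¹ (of i))) = lift (stdTuple n a b c) (α (α⁻¹ (of i))) := by
    rw [lift_mulAut_comp, lift_aut_eq hy', ← lift_mulAut_comp, hσ, lift_aut_eq (hα c hc)]
  simpa using h1

/-- The transvection `x_j ↦ x_j u` fixes the tuples on which `u` is trivial. -/
theorem update (y : Fin n → G) {j : Fin n} {u : FreeGroup (Fin n)} (hu : u ∈ others j)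
    (hS : ∀ c ∈ S, lift (stdTuple n a b c) u = 1) :
    Reach a b S y (Function.update y j (y j * lift y u)) := by
  refine ⟨transvection j u hu, fun c hc i => ?_, fun i => ?_⟩
  · by_cases h : i = j
    · subst h
      rw [transvection_self, _root_.map_mul, hS c hc]
      simp
    · rw [transvection_of_ne h]
      simp
  · by_cases h : i = j
    · subst h
      rw [transvection_self]
      simp
    · rw [transvection_of_ne h]
      simp [h]

/-- Conjugates of the entries in which the tuples to be fixed are trivial may be added to the other
entries. -/
theorem update_conj (y : Fin n → G) {f i : Fin n} (hfi : f ≠ i) (hi : 3 ≤ i.1)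
    {w : FreeGroup (Fin n)} (hw : w ∈ others f) :
    Reach a b S y (Function.update y f (y f * (lift y w * y i * (lift y w)⁻¹))) := by
  have h1 := Reach.update (a := a) (b := b) (S := S) y (j := f) (u := w * of i * w⁻¹)
    (mul_mem (mul_mem hw (of_mem_others hfi.symm)) (inv_mem hw)) (fun c _ => by
      simp [stdTuple_of_three_le a b c hi])
  simpa using h1

end Reach

/-- The first three entries of `y` generate the Tarski monster, and no automorphism carries them to
`(a, b, c)` with `c ∈ S`. -/
def IsGood (a b : G) (S : Finset G) (y : Fin n → G) : Prop :=
  (∃ e f : Fin n, e.1 < 3 ∧ f.1 < 3 ∧ ¬ Commute (y e) (y f)) ∧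
    ∀ c ∈ S, ∀ σ : MulAut G, ∃ i : Fin n, i.1 < 3 ∧ σ (y i) ≠ stdTuple n a b c i

theorem closure_le_others {j : Fin n} (hj : 3 ≤ j.1) :
    Subgroup.closure (of '' {i : Fin n | i.1 < 3}) ≤ others j :=
  Subgroup.closure_mono (Set.image_mono fun i hi h => by
    rw [Set.mem_singleton_iff] at h
    subst h
    exact absurd hi (not_lt.2 hj))

namespace IsTarskiMonster

/-- Only finitely many values of one coordinate make a triple equivalent to one of finitely many
given triples, as soon as its other two coordinates do not commute. -/
theorem finite_bad (hG : IsTarskiMonster G) (S : Finset G) {x z : G} (hxz : ¬ Commute x z)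
    (x' y' z' : G → G) :
    {v | ∃ c ∈ S, ∃ σ : MulAut G, σ x = x' c ∧ σ z = y' c ∧ σ v = z' c}.Finite := by
  have h1 : {v | ∃ c ∈ S, ∃ σ : MulAut G, σ x = x' c ∧ σ z = y' c ∧ σ v = z' c} =
      ⋃ c ∈ S, {v | ∃ σ : MulAut G, σ x = x' c ∧ σ z = y' c ∧ σ v = z' c} := by
    ext v; simp
  rw [h1]
  exact S.finite_toSet.biUnion fun c _ => hG.finite_setOf_exists_mulAut hxz _ _ _

theorem surjective_lift_stdTuple {a b : G} (hG : IsTarskiMonster G) (hn : 4 ≤ n)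
    (hab : ¬ Commute a b) (c : G) : Function.Surjective (lift (stdTuple n a b c)) := by
  rw [lift_surjective_iff]
  exact hG.eq_top_of_not_commute (Subgroup.subset_closure ⟨⟨0, by omega⟩, by simp [stdTuple]⟩)
    (Subgroup.subset_closure ⟨⟨1, by omega⟩, by simp [stdTuple]⟩) hab

variable [IsSimpleGroup G] {a b : G} {S : Finset G} {y : Fin n → G}

/-- Some word in the first three letters is trivial on all tuples to be fixed and takes an arbitrary
value on a good tuple. -/
theorem exists_word (hG : IsTarskiMonster G) (hn : 4 ≤ n) (hab : ¬ Commute a b)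
    (hy : IsGood a b S y) (v : G) : ∃ u ∈ Subgroup.closure (of '' {i : Fin n | i.1 < 3}),
      (∀ c ∈ S, lift (stdTuple n a b c) u = 1) ∧ lift y u = v := by
  set F := Subgroup.closure (of '' {i : Fin n | i.1 < 3}) with hF
  have hsurj : ∀ {z : Fin n → G} {e f : Fin n}, e.1 < 3 → f.1 < 3 → ¬ Commute (z e) (z f) →
      Function.Surjective ((lift z).comp F.subtype) := by
    intro z e f he hf hef
    rw [← MonoidHom.range_eq_top]
    refine hG.eq_top_of_not_commute
      ⟨⟨of e, Subgroup.subset_closure ⟨e, he, rfl⟩⟩, ?_⟩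
      ⟨⟨of f, Subgroup.subset_closure ⟨f, hf, rfl⟩⟩, ?_⟩ hef <;> simp
  obtain ⟨⟨e, f, he, hf, hef⟩, hne⟩ := hy
  have hy' := hsurj he hf hef
  have hstd : ∀ c, Function.Surjective ((lift (stdTuple n a b c)).comp F.subtype) := fun c =>
    hsurj (e := ⟨0, by omega⟩) (f := ⟨1, by omega⟩) (by simp) (by simp) (by simpa [stdTuple])
  have htop := hG.map_iInf_ker_eq_top hy' (fun c => (lift (stdTuple n a b c)).comp F.subtype) S (by
    intro c hc hker
    obtain ⟨σ, hσ⟩ := exists_mulAut_of_ker_le (hstd c) hy' hker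
    obtain ⟨i, hi, hne⟩ := hne c hc σ
    exact hne (by simpa using hσ ⟨of i, Subgroup.subset_closure ⟨i, hi, rfl⟩⟩))
  have hv : v ∈ (⨅ c ∈ S, ((lift (stdTuple n a b c)).comp F.subtype).ker).map
      ((lift y).comp F.subtype) := htop ▸ Subgroup.mem_top v
  obtain ⟨u, hu, rfl⟩ := hv
  refine ⟨u, u.2, fun c hc => ?_, rfl⟩
  have h1 : u ∈ ⨅ c ∈ S, ((lift (stdTuple n a b c)).comp F.subtype).ker := hu
  rw [Subgroup.mem_iInf] at h1
  have h2 := h1 c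
  rw [Subgroup.mem_iInf] at h2
  exact h2 hc

/-- The entries of a good tuple after the third are arbitrary. -/
theorem reach_of_eq (hG : IsTarskiMonster G) (hn : 4 ≤ n) (hab : ¬ Commute a b)
    (hy : IsGood a b S y) {y' : Fin n → G} (h : ∀ i : Fin n, i.1 < 3 → y' i = y i) :
    Reach a b S y y' := by
  classical
  have key : ∀ T : Finset (Fin n), (∀ i ∈ T, 3 ≤ i.1) →
      Reach a b S y fun i => if i ∈ T then y' i else y i := by
    intro T
    induction T using Finset.induction_on with
    | empty => intro _; simpa using Reach.refl y
    | insert j T hjT ih =>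
      intro hT
      have hj := hT j (Finset.mem_insert_self j T)
      refine (ih fun i hi => hT i (Finset.mem_insert_of_mem hi)).trans ?_
      set z : Fin n → G := fun i => if i ∈ T then y' i else y i with hz
      obtain ⟨u, hu, huS, huy⟩ := hG.exists_word hn hab hy ((y j)⁻¹ * y' j)
      have hzu : lift z u = (y j)⁻¹ * y' j := by
        rw [← huy]
        refine lift_eq_of_eqOn (fun i hi => ?_) hu
        by_cases hiT : i ∈ T
        · simp only [hz, if_pos hiT, h i hi]
        · simp only [hz, if_neg hiT]
      have h1 := Reach.update z (closure_le_others hj hu) huS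
      convert h1 using 1
      funext i
      by_cases hij : i = j
      · subst hij
        rw [Function.update_self, hzu]
        simp [hz, hjT]
      · simp [hz, hij]
  have h1 := key (Finset.univ.filter fun i => 3 ≤ i.1) (by simp)
  convert h1 using 1
  funext i
  by_cases hi : 3 ≤ i.1
  · simp [hi]
  · simp [hi, h i (by omega)]

/-- Any of the first three entries of a good tuple may be changed arbitrarily. -/
theorem exists_reach_update (hG : IsTarskiMonster G) (hn : 4 ≤ n) (hab : ¬ Commute a b)
    (hy : IsGood a b S y) {j : Fin n} (hj : j.1 < 3) (v : G) :
    ∃ y', Reach a b S y y' ∧ y' j = v ∧ ∀ i : Fin n, i.1 < 3 → i ≠ j → y' i = y i := by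
  let l : Fin n := ⟨3, by omega⟩
  have hjl : j ≠ l := fun h => by rw [h] at hj; simp [l] at hj
  set z := Function.update y l ((y j)⁻¹ * v) with hz
  have h1 : Reach a b S y z := hG.reach_of_eq hn hab hy fun i hi => by
    rw [hz, Function.update_of_ne]
    rintro rfl
    simp [l] at hi
  have h2 := Reach.update_conj (a := a) (b := b) (S := S) z hjl (le_refl 3) (one_mem (others j))
  refine ⟨_, h1.trans h2, ?_, fun i hi hij => ?_⟩
  · simp [hz, hjl]
  · have hil : i ≠ l := fun h => by rw [h] at hi; simp [l] at hi
    rw [Function.update_of_ne hij, hz, Function.update_of_ne hil]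

end IsTarskiMonster

end

/-! ### High transitivity -/

section

variable {G : Type*} [Group G] {n : ℕ}

theorem isGood_of_forall (hn : 4 ≤ n) {a b : G} {S : Finset G} {y : Fin n → G}
    {e f : Fin n} (he : e.1 < 3) (hf : f.1 < 3) (hef : ¬ Commute (y e) (y f))
    (h : ∀ c ∈ S, ∀ σ : MulAut G, σ (y ⟨0, by omega⟩) = a → σ (y ⟨1, by omega⟩) = b →
      σ (y ⟨2, by omega⟩) ≠ c) : IsGood a b S y := by
  refine ⟨⟨e, f, he, hf, hef⟩, fun c hc σ => ?_⟩
  by_contra! hcon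
  have h0 := hcon ⟨0, by omega⟩ (by simp)
  have h1 := hcon ⟨1, by omega⟩ (by simp)
  have h2 := hcon ⟨2, by omega⟩ (by simp)
  simp only [stdTuple, if_true, one_ne_zero, if_false, OfNat.ofNat_ne_zero, OfNat.ofNat_ne_one]
    at h0 h1 h2
  exact h c hc σ h0 h1 h2

theorem ne_one_of_not_commute {x y : G} (h : ¬ Commute x y) : x ≠ 1 := by
  rintro rfl
  exact h (Commute.one_left y)

namespace IsTarskiMonster

variable [IsSimpleGroup G] {a b : G} {S : Finset G} {y : Fin n → G}

/-- A good tuple is moved to `(a, b, c, 1, …, 1)` through tuples that start with `(y₀, y₁, z)`,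
`(y₀, w, z)`, `(a, w, z)` and `(a, b, z)`; these are good for generic `z` and `w`. -/
theorem reach_stdTuple_of_not_commute (hG : IsTarskiMonster G) (hn : 4 ≤ n) (hab : ¬ Commute a b)
    (hy : IsGood a b S y) (h01 : ¬ Commute (y ⟨0, by omega⟩) (y ⟨1, by omega⟩)) {c : G}
    (hc : c ∉ S) : Reach a b S y (stdTuple n a b c) := by
  have := hG.infinite
  let i₀ : Fin n := ⟨0, by omega⟩
  let i₁ : Fin n := ⟨1, by omega⟩
  let i₂ : Fin n := ⟨2, by omega⟩
  have l0 : i₀.1 < 3 := by simp [i₀]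
  have l1 : i₁.1 < 3 := by simp [i₁]
  have l2 : i₂.1 < 3 := by simp [i₂]
  have n01 : i₀ ≠ i₁ := by simp [i₀, i₁]
  have n02 : i₀ ≠ i₂ := by simp [i₀, i₂]
  have n12 : i₁ ≠ i₂ := by simp [i₁, i₂]
  -- `z` avoids the values for which `(y₀, y₁, z)` or `(a, b, z)` is equivalent to a fixed triple.
  obtain ⟨z, hz0, hza, hz⟩ := hG.exists_not_commute_and_notMem (ne_one_of_not_commute h01)
    (ne_one_of_not_commute hab)
    ((hG.finite_bad S h01 (fun _ => a) (fun _ => b) id).union S.finite_toSet)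
  -- `w` avoids the values for which `(y₀, w, z)` or `(a, w, z)` is equivalent to a fixed triple.
  obtain ⟨w, hw⟩ := ((hG.finite_bad S hz0 (fun _ => a) id (fun _ => b)).union
    (hG.finite_bad S hza (fun _ => a) id (fun _ => b))).exists_notMem
  obtain ⟨y₁, r1, h12, h1⟩ := hG.exists_reach_update hn hab hy l2 z
  have e10 : y₁ i₀ = y i₀ := h1 i₀ l0 n02
  have e11 : y₁ i₁ = y i₁ := h1 i₁ l1 n12
  have g1 : IsGood a b S y₁ := isGood_of_forall hn l0 l1 (by rw [e10, e11]; exact h01)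
    fun d hd σ q0 q1 q2 => hz (Or.inl ⟨d, hd, σ, e10 ▸ q0, e11 ▸ q1, h12 ▸ q2⟩)
  obtain ⟨y₂, r2, h21, h2⟩ := hG.exists_reach_update hn hab g1 l1 w
  have e20 : y₂ i₀ = y i₀ := (h2 i₀ l0 n01).trans e10
  have e22 : y₂ i₂ = z := (h2 i₂ l2 n12.symm).trans h12
  have g2 : IsGood a b S y₂ := isGood_of_forall hn l0 l2 (by rw [e20, e22]; exact hz0)
    fun d hd σ q0 q1 q2 => hw (Or.inl ⟨d, hd, σ, e20 ▸ q0, e22 ▸ q2, h21 ▸ q1⟩)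
  obtain ⟨y₃, r3, h30, h3⟩ := hG.exists_reach_update hn hab g2 l0 a
  have e31 : y₃ i₁ = w := (h3 i₁ l1 n01.symm).trans h21
  have e32 : y₃ i₂ = z := (h3 i₂ l2 n02.symm).trans e22
  have g3 : IsGood a b S y₃ := isGood_of_forall hn l0 l2 (by rw [h30, e32]; exact hza)
    fun d hd σ q0 q1 q2 => hw (Or.inr ⟨d, hd, σ, h30 ▸ q0, e32 ▸ q2, e31 ▸ q1⟩)
  obtain ⟨y₄, r4, h41, h4⟩ := hG.exists_reach_update hn hab g3 l1 b
  have e40 : y₄ i₀ = a := (h4 i₀ l0 n01).trans h30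
  have e42 : y₄ i₂ = z := (h4 i₂ l2 n12.symm).trans e32
  have hfix : ∀ σ : MulAut G, σ a = a → σ b = b → σ = 1 := fun σ ha hb =>
    hG.mulAut_eq hab (τ := 1) ha hb
  have g4 : IsGood a b S y₄ := isGood_of_forall hn l0 l1 (by rw [e40, h41]; exact hab)
    fun d hd σ q0 q1 q2 => by
      have hσ := hfix σ (e40 ▸ q0) (h41 ▸ q1)
      have hzd : z = d := by
        rw [← q2, hσ]
        exact e42.symm
      exact hz (Or.inr (hzd ▸ hd))
  obtain ⟨y₅, r5, h52, h5⟩ := hG.exists_reach_update hn hab g4 l2 c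
  have e50 : y₅ i₀ = a := (h5 i₀ l0 n02).trans e40
  have e51 : y₅ i₁ = b := (h5 i₁ l1 n12).trans h41
  have g5 : IsGood a b S y₅ := isGood_of_forall hn l0 l1 (by rw [e50, e51]; exact hab)
    fun d hd σ q0 q1 q2 => by
      have hσ := hfix σ (e50 ▸ q0) (e51 ▸ q1)
      have hcd : c = d := by
        rw [← q2, hσ]
        exact h52.symm
      exact hc (hcd ▸ hd)
  have r6 : Reach a b S y₅ (stdTuple n a b c) := hG.reach_of_eq hn hab g5 fun i hi => by
    obtain ⟨i, hin⟩ := i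
    have hi' : i < 3 := hi
    interval_cases i
    · exact e50.symm
    · exact e51.symm
    · exact h52.symm
  exact r1.trans (r2.trans (r3.trans (r4.trans (r5.trans r6))))

theorem reach_stdTuple_of_isGood (hG : IsTarskiMonster G) (hn : 4 ≤ n) (hab : ¬ Commute a b)
    (hy : IsGood a b S y) {c : G} (hc : c ∉ S) : Reach a b S y (stdTuple n a b c) := by
  let i₀ : Fin n := ⟨0, by omega⟩
  let i₁ : Fin n := ⟨1, by omega⟩
  let i₂ : Fin n := ⟨2, by omega⟩
  have l0 : i₀.1 < 3 := by simp [i₀]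
  have l1 : i₁.1 < 3 := by simp [i₁]
  have n01 : i₀ ≠ i₁ := by simp [i₀, i₁]
  have n02 : i₀ ≠ i₂ := by simp [i₀, i₂]
  have n12 : i₁ ≠ i₂ := by simp [i₁, i₂]
  have l2 : i₂.1 < 3 := by simp [i₂]
  by_cases h01 : Commute (y i₀) (y i₁)
  swap
  · exact hG.reach_stdTuple_of_not_commute hn hab hy h01 hc
  by_cases h02 : Commute (y i₀) (y i₂)
  swap
  · obtain ⟨w, hw, -, hwS⟩ := hG.exists_not_commute_and_notMem (ne_one_of_not_commute h02)
      (ne_one_of_not_commute h02) (hG.finite_bad S h02 (fun _ => a) id (fun _ => b))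
    obtain ⟨y', r, h1, h⟩ := hG.exists_reach_update hn hab hy l1 w
    have e0 : y' i₀ = y i₀ := h i₀ l0 n01
    have e2 : y' i₂ = y i₂ := h i₂ l2 n12.symm
    have h01' : ¬ Commute (y' i₀) (y' i₁) := by rw [e0, h1]; exact hw
    have g : IsGood a b S y' := isGood_of_forall hn l0 l1 h01'
      fun d hd σ q0 q1 q2 => hwS ⟨d, hd, σ, e0 ▸ q0, e2 ▸ q2, h1 ▸ q1⟩
    exact r.trans (hG.reach_stdTuple_of_not_commute hn hab g h01' hc)
  by_cases h12 : Commute (y i₁) (y i₂)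
  swap
  · obtain ⟨w, hw, -, hwS⟩ := hG.exists_not_commute_and_notMem (ne_one_of_not_commute h12)
      (ne_one_of_not_commute h12) (hG.finite_bad S h12 (fun _ => b) id (fun _ => a))
    obtain ⟨y', r, h0, h⟩ := hG.exists_reach_update hn hab hy l0 w
    have e1 : y' i₁ = y i₁ := h i₁ l1 n01.symm
    have e2 : y' i₂ = y i₂ := h i₂ l2 n02.symm
    have h01' : ¬ Commute (y' i₀) (y' i₁) := by rw [e1, h0]; exact fun h => hw h.symm
    have g : IsGood a b S y' := isGood_of_forall hn l0 l1 h01'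
      fun d hd σ q0 q1 q2 => hwS ⟨d, hd, σ, e1 ▸ q1, e2 ▸ q2, h0 ▸ q0⟩
    exact r.trans (hG.reach_stdTuple_of_not_commute hn hab g h01' hc)
  exfalso
  obtain ⟨⟨⟨e, hen⟩, ⟨f, hfn⟩, he, hf, hef⟩, -⟩ := hy
  have he' : e < 3 := he
  have hf' : f < 3 := hf
  apply hef
  interval_cases e <;> interval_cases f <;>
    first
    | exact Commute.refl _
    | assumption
    | exact Commute.symm (by assumption)

/-- If one of the first three entries is nontrivial, two of them can be made not to commute. -/
theorem exists_reach_not_commute_of_ne_one (hG : IsTarskiMonster G) (hn : 4 ≤ n)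
    (hy : Function.Surjective (lift y)) {e : Fin n} (he : e.1 < 3) (hye : y e ≠ 1) :
    ∃ y', Reach a b S y y' ∧ ∃ e f : Fin n, e.1 < 3 ∧ f.1 < 3 ∧ ¬ Commute (y' e) (y' f) := by
  by_cases hcomm : ∃ f : Fin n, f.1 < 3 ∧ ¬ Commute (y e) (y f)
  · obtain ⟨f, hf, h⟩ := hcomm
    exact ⟨y, Reach.refl y, e, f, he, hf, h⟩
  push Not at hcomm
  obtain ⟨i, hi⟩ : ∃ i, ¬ Commute (y e) (y i) := by
    by_contra! hcon
    apply hG.centralizer_ne_top hye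
    rw [eq_top_iff, ← lift_surjective_iff.1 hy, Subgroup.closure_le]
    rintro _ ⟨i, rfl⟩
    exact Subgroup.mem_centralizer_singleton_iff.2 (hcon i).eq.symm
  have hi3 : 3 ≤ i.1 := by
    by_contra h
    exact hi (hcomm i (by omega))
  obtain ⟨f, hf, hfe⟩ : ∃ f : Fin n, f.1 < 3 ∧ f ≠ e := by
    by_cases h : e.1 = 0
    · exact ⟨⟨1, by omega⟩, by simp, fun h' => by rw [← h'] at h; simp at h⟩
    · exact ⟨⟨0, by omega⟩, by simp, fun h' => by rw [← h'] at h; simp at h⟩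
  have hfi : f ≠ i := fun h => by rw [h] at hf; omega
  refine ⟨_, Reach.update_conj y hfi hi3 (one_mem _), e, f, he, hf, ?_⟩
  rw [Function.update_self, Function.update_of_ne hfe.symm]
  intro h
  apply hi
  have h1 : y i = (y f)⁻¹ * (y f * (lift y 1 * y i * (lift y 1)⁻¹)) := by simp
  rw [h1]
  exact (hcomm f hf).inv_right.mul_right h

theorem exists_reach_not_commute (hG : IsTarskiMonster G) (hn : 4 ≤ n)
    (hy : Function.Surjective (lift y)) :
    ∃ y', Reach a b S y y' ∧ ∃ e f : Fin n, e.1 < 3 ∧ f.1 < 3 ∧ ¬ Commute (y' e) (y' f) := by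
  by_cases h : ∃ e : Fin n, e.1 < 3 ∧ y e ≠ 1
  · obtain ⟨e, he, hye⟩ := h
    exact hG.exists_reach_not_commute_of_ne_one hn hy he hye
  push Not at h
  obtain ⟨i, hi⟩ : ∃ i, y i ≠ 1 := by
    by_contra! hcon
    apply (bot_ne_top : (⊥ : Subgroup G) ≠ ⊤)
    rw [← lift_surjective_iff.1 hy, eq_comm, Subgroup.closure_eq_bot_iff]
    rintro _ ⟨i, rfl⟩
    exact hcon i
  have hi3 : 3 ≤ i.1 := by
    by_contra h'
    exact hi (h i (by omega))
  let f : Fin n := ⟨0, by omega⟩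
  have hf : f.1 < 3 := by simp [f]
  have hfi : f ≠ i := fun h => by rw [h] at hf; omega
  have r : Reach a b S y _ := Reach.update_conj y hfi hi3 (one_mem _)
  obtain ⟨y', r', h'⟩ := hG.exists_reach_not_commute_of_ne_one (a := a) (b := b) (S := S) hn
    (r.surjective hy) hf (by simpa [h f hf] using hi)
  exact ⟨y', r.trans r', h'⟩

/-- A generating tuple not equivalent to the tuples to be fixed can be made good: if its first three
entries are equivalent to `(a, b, c)`, then the third is multiplied by one of the infinitely many
conjugates of a later entry. -/
theorem exists_reach_isGood (hG : IsTarskiMonster G) (hn : 4 ≤ n) (hab : ¬ Commute a b)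
    (hy : Function.Surjective (lift y))
    (hne : ∀ c ∈ S, ∀ σ : MulAut G, σ ∘ y ≠ stdTuple n a b c) :
    ∃ y', Reach a b S y y' ∧ IsGood a b S y' := by
  classical
  obtain ⟨z, r, e, f, he, hf, hef⟩ := hG.exists_reach_not_commute (a := a) (b := b) (S := S) hn hy
  have hzne := r.inequivalent hne
  by_cases hgood : IsGood a b S z
  · exact ⟨z, r, hgood⟩
  obtain ⟨c, hc, σ, hσ⟩ : ∃ c ∈ S, ∃ σ : MulAut G, ∀ i : Fin n, i.1 < 3 →
      σ (z i) = stdTuple n a b c i := by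
    by_contra! hcon
    exact hgood ⟨⟨e, f, he, hf, hef⟩, hcon⟩
  obtain ⟨i, hi⟩ := Function.ne_iff.1 (hzne c hc σ)
  have hi3 : 3 ≤ i.1 := by
    by_contra h
    exact hi (hσ i (by omega))
  rw [stdTuple_of_three_le a b c hi3, Function.comp_apply] at hi
  obtain ⟨h, hh⟩ := hG.exists_conj_notMem hi (S.image fun d => c⁻¹ * d)
  let i₀ : Fin n := ⟨0, by omega⟩
  let i₁ : Fin n := ⟨1, by omega⟩
  let i₂ : Fin n := ⟨2, by omega⟩
  have l0 : i₀.1 < 3 := by simp [i₀]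
  have l1 : i₁.1 < 3 := by simp [i₁]
  have l2 : i₂.1 < 3 := by simp [i₂]
  have n02 : i₀ ≠ i₂ := by simp [i₀, i₂]
  have n12 : i₁ ≠ i₂ := by simp [i₁, i₂]
  have hi2 : i₂ ≠ i := fun h => by rw [h] at l2; omega
  have s0 : σ (z i₀) = a := hσ i₀ l0
  have s1 : σ (z i₁) = b := hσ i₁ l1
  have s2 : σ (z i₂) = c := hσ i₂ l2
  obtain ⟨w, hw, hwh⟩ : ∃ w ∈ Subgroup.closure (of '' {i₀, i₁} : Set (FreeGroup (Fin n))),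
      lift (σ ∘ z) w = h := by
    have h1 : (Subgroup.closure (of '' {i₀, i₁} : Set (FreeGroup (Fin n)))).map
        (lift (σ ∘ z)) = ⊤ :=
      hG.eq_top_of_not_commute (a := a) (b := b)
        ⟨of i₀, Subgroup.subset_closure ⟨i₀, by simp, rfl⟩, by simpa using s0⟩
        ⟨of i₁, Subgroup.subset_closure ⟨i₁, by simp, rfl⟩, by simpa using s1⟩ hab
    obtain ⟨w, hw, hwh⟩ : h ∈ (Subgroup.closure (of '' {i₀, i₁} : Set (FreeGroup (Fin n)))).map
        (lift (σ ∘ z)) := h1 ▸ Subgroup.mem_top h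
    exact ⟨w, hw, hwh⟩
  have hw2 : w ∈ others i₂ := by
    refine Subgroup.closure_mono (Set.image_mono fun j hj => ?_) hw
    rcases hj with rfl | rfl
    · exact n02
    · exact n12
  have r' : Reach a b S z _ := Reach.update_conj z hi2 hi3 hw2
  refine ⟨_, r.trans r', isGood_of_forall hn l0 l1 ?_ ?_⟩
  · rw [Function.update_of_ne n02, Function.update_of_ne n12]
    intro hcomm
    apply hab
    rw [← s0, ← s1]
    exact hcomm.map σ
  · intro d hd τ q0 q1 q2
    change τ (Function.update z i₂ _ i₀) = a at q0
    change τ (Function.update z i₂ _ i₁) = b at q1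
    change τ (Function.update z i₂ _ i₂) = d at q2
    rw [Function.update_of_ne n02] at q0
    rw [Function.update_of_ne n12] at q1
    rw [Function.update_self] at q2
    have hz01 : ¬ Commute (z i₀) (z i₁) := fun hcomm => hab (by
      rw [← s0, ← s1]
      exact hcomm.map σ)
    obtain rfl : τ = σ := hG.mulAut_eq hz01 (q0.trans s0.symm) (q1.trans s1.symm)
    rw [lift_mulAut_comp] at hwh
    rw [_root_.map_mul, _root_.map_mul, _root_.map_mul, _root_.map_inv, hwh, s2] at q2
    apply hh
    rw [Finset.mem_image]
    exact ⟨d, hd, by rw [← q2, inv_mul_cancel_left]⟩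

end IsTarskiMonster

/-- The class of the generating tuple `(a, b, c, 1, …, 1)`. -/
def stdClass (hG : IsTarskiMonster G) (hn : 4 ≤ n) {a b : G}
    (hab : ¬ Commute a b) (c : G) : GenTupleClass n G :=
  GenTupleClass.mk ⟨stdTuple n a b c, lift_surjective_iff.1 (hG.surjective_lift_stdTuple hn hab c)⟩

namespace IsTarskiMonster

variable [IsSimpleGroup G] {a b : G}

/-- The stabilizer of finitely many of the classes of `(a, b, c, 1, …, 1)` moves every other
point to any other such class. -/
theorem exists_smul_eq_stdClass (hG : IsTarskiMonster G) (hn : 4 ≤ n) (hab : ¬ Commute a b)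
    (S : Finset G) (x : GenTupleClass n G) (hx : ∀ c ∈ S, x ≠ stdClass hG hn hab c) {c : G}
    (hc : c ∉ S) : ∃ γ : Out (FreeGroup (Fin n)),
      (∀ d ∈ S, γ • stdClass hG hn hab d = stdClass hG hn hab d) ∧
        γ • x = stdClass hG hn hab c := by
  obtain ⟨y, rfl⟩ : ∃ y : GenTuple n G, GenTupleClass.mk y = x := Quotient.exists_rep x
  have hne : ∀ d ∈ S, ∀ σ : MulAut G, σ ∘ y.1 ≠ stdTuple n a b d := fun d hd σ h =>
    hx d hd (Quotient.sound ⟨σ, fun i => congrFun h i⟩)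
  obtain ⟨y', r, hgood⟩ := hG.exists_reach_isGood hn hab (lift_surjective_iff.2 y.2) hne
  obtain ⟨α, hα, hy⟩ := r.trans (hG.reach_stdTuple_of_isGood hn hab hgood hc)
  refine ⟨QuotientGroup.mk α⁻¹, fun d hd => ?_, ?_⟩
  · refine congrArg GenTupleClass.mk (Subtype.ext (funext fun i => ?_))
    change lift (stdTuple n a b d) (α⁻¹⁻¹ (of i)) = _
    rw [inv_inv]
    exact hα d hd i
  · refine congrArg GenTupleClass.mk (Subtype.ext (funext fun i => ?_))
    change lift y.1 (α⁻¹⁻¹ (of i)) = _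
    rw [inv_inv]
    exact hy i

theorem isHighlyTransitive (hG : IsTarskiMonster G) (hn : 4 ≤ n) :
    IsHighlyTransitive (Out (FreeGroup (Fin n))) (GenTupleClass n G) := by
  classical
  obtain ⟨a, b, hab⟩ := hG.exists_not_commute
  have := hG.infinite
  let c : ℕ ↪ G := Infinite.natEmbedding G
  have key : ∀ (k : ℕ) (x : Fin k ↪ GenTupleClass n G), ∃ γ : Out (FreeGroup (Fin n)),
      ∀ j, γ • x j = stdClass hG hn hab (c j) := by
    intro k
    induction k with
    | zero => exact fun x => ⟨1, fun j => j.elim0⟩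
    | succ k ih =>
      intro x
      obtain ⟨γ, hγ⟩ := ih (Fin.castSuccEmb.trans x)
      have hγ' : ∀ j : Fin k, γ • x j.castSucc = stdClass hG hn hab (c j) := hγ
      obtain ⟨δ, hδ, hδx⟩ := hG.exists_smul_eq_stdClass hn hab
        ((Finset.range k).image c) (γ • x (Fin.last k)) (by
          intro d hd h
          obtain ⟨j, hj, rfl⟩ := Finset.mem_image.1 hd
          have hj' := Finset.mem_range.1 hj
          rw [show j = ((⟨j, hj'⟩ : Fin k) : ℕ) from rfl, ← hγ' ⟨j, hj'⟩] at h
          have h1 := x.injective (smul_left_cancel γ h)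
          exact absurd h1 (Fin.castSucc_lt_last _).ne')
        (c := c k) (by simp)
      refine ⟨δ * γ, fun j => ?_⟩
      rw [mul_smul]
      refine Fin.lastCases ?_ (fun j => ?_) j
      · simpa using hδx
      · rw [hγ' j]
        exact hδ _ (Finset.mem_image_of_mem c (Finset.mem_range.2 j.2))
  intro k
  rw [MulAction.isMultiplyPretransitive_iff]
  intro x y
  obtain ⟨γ, hγ⟩ := key k x
  obtain ⟨δ, hδ⟩ := key k y
  refine ⟨δ⁻¹ * γ, ?_⟩
  ext j
  rw [Function.Embedding.smul_apply, mul_smul, hγ, ← hδ, inv_smul_smul]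

end IsTarskiMonster

end

theorem theorem1 (G : Type*) [Group G] [IsSimpleGroup G] (hG : IsTarskiMonster G)
    (n : ℕ) (hn : 4 ≤ n) :
    IsHighlyTransitive (Out (FreeGroup (Fin n))) (GenTupleClass n G) ∧
      (FaithfulSMul (Out (FreeGroup (Fin n))) (GenTupleClass n G) ↔ ¬ SatisfiesGroupLaw G) := by
  refine ⟨hG.isHighlyTransitive hn, fun hfaith hlaw => ?_, fun hlaw =>
    hG.faithfulSMul hlaw (by omega)⟩
  exact hlaw.not_faithfulSMul (i := ⟨0, by omega⟩) (j := ⟨1, by omega⟩) (l := ⟨2, by omega⟩)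
    (by simp) (by simp) (by simp) hfaith
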